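/- Let $q\in L^1_{\mathrm{loc}}(\mathbb R)$ be real valued and even, $q(x)=q(-x)$ for all $x\in\mathbb R$, and let $\tau_q(y)=-y''-qy$. Assume that $\tau_q$ is in the limit circle case at $+\infty$ and at $-\infty$: for every $\lambda\in\mathbb C$, every solution $y$ (with $y,y'\in AC_{\mathrm{loc}}(\mathbb R)$) of $\tau_q(y)-\lambda y=0$ belongs to $L^2((a,\infty))$ and to $L^2((-\infty,b))$ for some $a,b\in\mathbb R$. Let $A_{\max}$ be the maximal operator in $L^2(\mathbb R)$, $A_{\max}y=\tau_q(y)$ on $\{y\in L^2(\mathbb R): y,y'\in AC_{\mathrm{loc}}(\mathbb R),\ \tau_q(y)\in L^2(\mathbb R)\}$, let $A_0$ be its restriction to the compactly supported functions in its domain, and let $A=\overline{A_0}$ be the minimal operator. For $r\in\mathbb N$, an $r$-dimensional bi-extension of $A$ is a closed operator $\widetilde A$ with $A\subset\widetilde A\subset A^*$ and $\dim(\operatorname{dom}\widetilde A/\operatorname{dom}A)=r$. A closed densely defined operator $T$ in $L^2(\mathbb R)$ is called $\mathcal{PT}$-symmetric if for all $f\in\operatorname{dom}T$ one has $\mathcal{PT}f\in\operatorname{dom}T$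 and $\mathcal{PT}\,Tf=T\,\mathcal{PT}f$, where $(\mathcal{PT}f)(x)=\overline{f(-x)}$. Then every $1$-dimensional bi-extension $\widetilde A$ of $A$ satisfies $\sigma(\widetilde A)=\mathbb C$; moreover, its adjoint $\widetilde A^*$ is a $3$-dimensional bi-extension of $A$ with empty resolvent set. In particular, there exist $\mathcal{PT}$-symmetric $1$-dimensional bi-extensions of $A$ with empty resolvent set. -/

import Mathlib

open MeasureTheory Set

open scoped LinearPMap

namespace PTSymmetric

noncomputable section

/-- The Hilbert space `L²(ℝ)` of complex valued square integrable functions. -/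
abbrev L2R : Type := Lp ℂ 2 (volume : Measure ℝ)

section AbstractOperators

variable {H : Type*} [NormedAddCommGroup H] [InnerProductSpace ℂ H]

/-- The resolvent set of an unbounded operator `T` in `H`: the complex numbers `z` for which
`T - z : dom T → H` has an everywhere defined bounded two-sided inverse. -/
def resolventSet (T : H →ₗ.[ℂ] H) : Set ℂ :=
  {z | ∃ R : H →L[ℂ] H,
    (∀ x : H, ∃ h : R x ∈ T.domain, T ⟨R x, h⟩ - z • R x = x) ∧
    ∀ u : T.domain, R (T u - z • (u : H)) = u}

/-- The spectrum of an unbounded operator. -/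
def spectrum (T : H →ₗ.[ℂ] H) : Set ℂ := (resolventSet T)ᶜ

/-- `B` is a bi-extension of `A`: a closed operator with `A ⊆ B ⊆ A*`. -/
def IsBiExtension [CompleteSpace H] (A B : H →ₗ.[ℂ] H) : Prop :=
  B.IsClosed ∧ A ≤ B ∧ B ≤ A†

/-- `B` is an `r`-dimensional bi-extension of `A`: moreover `dim (dom B / dom A) = r`. -/
def IsBiExtensionOfDim [CompleteSpace H] (A B : H →ₗ.[ℂ] H) (r : ℕ) : Prop :=
  IsBiExtension A B ∧
    Module.rank ℂ (B.domain ⧸ A.domain.comap B.domain.subtype) = (r : Cardinal)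

end AbstractOperators

/-- Parity reflection `(P f)(x) = f(-x)` on `L²(ℝ)`. -/
def parity (f : L2R) : L2R :=
  Lp.compMeasurePreserving (fun x : ℝ => -x) (Measure.measurePreserving_neg volume) f

/-- Time reversal `(T f)(x) = conj (f x)` on `L²(ℝ)`. -/
def timeReversal (f : L2R) : L2R := star f

/-- The antilinear operator `PT` on `L²(ℝ)`. -/
def pt (f : L2R) : L2R := parity (timeReversal f)

/-- A closed densely defined operator `T` in `L²(ℝ)` is `PT`-symmetric if `PT f ∈ dom T` and
`PT (T f) = T (PT f)` for all `f ∈ dom T`. -/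
def IsPTSymmetric (T : L2R →ₗ.[ℂ] L2R) : Prop :=
  T.IsClosed ∧ Dense (T.domain : Set L2R) ∧
    ∀ f : T.domain, ∃ h : pt f ∈ T.domain, pt (T f) = T ⟨pt f, h⟩

/-- `AC_loc(ℝ)`: complex functions that are absolutely continuous on all compact intervals. -/
def ACloc (y : ℝ → ℂ) : Prop := ∀ a b : ℝ, AbsolutelyContinuousOnInterval y a b

/-- `y, y' ∈ AC_loc(ℝ)`. -/
structure IsRegular (y : ℝ → ℂ) : Prop where
  differentiable : Differentiable ℝ y
  acloc : ACloc y
  acloc_deriv : ACloc (deriv y)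

/-- The differential expression `τ_q(y) = -y'' - q y`; for regular `y` it is meaningful at almost
every point. -/
def tau (q : ℝ → ℝ) (y : ℝ → ℂ) : ℝ → ℂ := fun x => -deriv (deriv y) x - (q x : ℂ) * y x

/-- `y` is a solution on `ℝ` of `τ_q(y) - z y = 0`. -/
def IsSolution (q : ℝ → ℝ) (z : ℂ) (y : ℝ → ℂ) : Prop :=
  IsRegular y ∧ ∀ᵐ x : ℝ, tau q y x - z * y x = 0

/-- `τ_q` is in the limit circle case at `+∞`. -/
def LimitCircleAtTop (q : ℝ → ℝ) : Prop :=
  ∀ (z : ℂ) (y : ℝ → ℂ), IsSolution q z y → ∃ a : ℝ, MemLp y 2 (volume.restrict (Ioi a))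

/-- `τ_q` is in the limit circle case at `-∞`. -/
def LimitCircleAtBot (q : ℝ → ℝ) : Prop :=
  ∀ (z : ℂ) (y : ℝ → ℂ), IsSolution q z y → ∃ a : ℝ, MemLp y 2 (volume.restrict (Iio a))

theorem IsRegular.ae_differentiableAt {y : ℝ → ℂ} (hy : IsRegular y) :
    ∀ᵐ x : ℝ, DifferentiableAt ℝ (deriv y) x := by
  have h : ∀ n : ℕ, ∀ᵐ x : ℝ, x ∈ uIcc (-(n : ℝ)) n → DifferentiableAt ℝ (deriv y) x := fun n =>
    (hy.acloc_deriv _ _).boundedVariationOn.ae_differentiableAt_of_mem_uIcc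
  filter_upwards [ae_all_iff.2 h] with x hx
  obtain ⟨n, hn⟩ := exists_nat_ge |x|
  exact hx n (by rw [uIcc_of_le (by linarith [abs_nonneg x])]; exact abs_le.1 hn)

theorem IsRegular.zero : IsRegular (0 : ℝ → ℂ) := by
  have h : ACloc (0 : ℝ → ℂ) := fun a b =>
    (contDiff_const (c := (0 : ℂ))).contDiffOn.absolutelyContinuousOnInterval
  refine ⟨differentiable_const (0 : ℂ), h, ?_⟩
  rwa [show deriv (0 : ℝ → ℂ) = 0 from funext fun x => deriv_const x (0 : ℂ)]

theorem IsRegular.add {y w : ℝ → ℂ} (hy : IsRegular y) (hw : IsRegular w) :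
    IsRegular (y + w) := by
  refine ⟨hy.1.add hw.1, fun a b => (hy.2 a b).add (hw.2 a b), ?_⟩
  rw [show deriv (y + w) = deriv y + deriv w from funext fun x => deriv_add (hy.1 x) (hw.1 x)]
  exact fun a b => (hy.3 a b).add (hw.3 a b)

theorem IsRegular.smul {y : ℝ → ℂ} (c : ℂ) (hy : IsRegular y) : IsRegular (c • y) := by
  refine ⟨hy.1.const_smul c, fun a b => (hy.2 a b).const_smul c, ?_⟩
  rw [show deriv (c • y) = c • deriv y from funext fun x => deriv_const_smul c (hy.1 x)]
  exact fun a b => (hy.3 a b).const_smul c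

theorem tau_zero (q : ℝ → ℝ) : tau q 0 = 0 := by
  have h : deriv (0 : ℝ → ℂ) = 0 := funext fun x => deriv_const x (0 : ℂ)
  funext x
  simp [tau, h]

theorem tau_add (q : ℝ → ℝ) {y w : ℝ → ℂ} (hy : IsRegular y) (hw : IsRegular w) :
    tau q (y + w) =ᵐ[volume] tau q y + tau q w := by
  filter_upwards [hy.ae_differentiableAt, hw.ae_differentiableAt] with x h1 h2
  have h : deriv (y + w) = deriv y + deriv w := funext fun x => deriv_add (hy.1 x) (hw.1 x)
  simp only [tau, h, Pi.add_apply, deriv_add h1 h2]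
  ring

theorem tau_smul (q : ℝ → ℝ) (c : ℂ) {y : ℝ → ℂ} (hy : IsRegular y) :
    tau q (c • y) =ᵐ[volume] c • tau q y := by
  filter_upwards [hy.ae_differentiableAt] with x h1
  have h : deriv (c • y) = c • deriv y := funext fun x => deriv_const_smul c (hy.1 x)
  simp only [tau, h, Pi.smul_apply, deriv_const_smul c h1, smul_eq_mul]
  ring

/-- The graph of the maximal operator: all pairs `(y, τ_q y)` with `y, y' ∈ AC_loc(ℝ)` and
`y, τ_q y ∈ L²(ℝ)`, the functions being identified with their classes in `L²(ℝ)`. -/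
def maximalGraph (q : ℝ → ℝ) : Submodule ℂ (L2R × L2R) where
  carrier := {p | ∃ y : ℝ → ℂ, IsRegular y ∧ p.1 =ᵐ[volume] y ∧ p.2 =ᵐ[volume] tau q y}
  zero_mem' := ⟨0, IsRegular.zero, Lp.coeFn_zero _ _ _, by
    rw [tau_zero]
    exact Lp.coeFn_zero _ _ _⟩
  add_mem' := by
    rintro p r ⟨y, hy, h1, h2⟩ ⟨w, hw, h3, h4⟩
    exact ⟨y + w, hy.add hw, (Lp.coeFn_add _ _).trans (h1.add h3),
      ((Lp.coeFn_add _ _).trans (h2.add h4)).trans (tau_add q hy hw).symm⟩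
  smul_mem' := by
    rintro c p ⟨y, hy, h1, h2⟩
    exact ⟨c • y, hy.smul c, (Lp.coeFn_smul _ _).trans (h1.const_smul c),
      ((Lp.coeFn_smul _ _).trans (h2.const_smul c)).trans (tau_smul q c hy).symm⟩

theorem maximalGraph_snd_eq_zero (q : ℝ → ℝ) (p : L2R × L2R) (hp : p ∈ maximalGraph q)
    (h0 : p.1 = 0) : p.2 = 0 := by
  obtain ⟨y, hy, h1, h2⟩ := hp
  have hy0 : y = 0 := by
    refine (Continuous.ae_eq_iff_eq volume hy.1.continuous continuous_zero).1 ?_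
    rw [h0] at h1
    exact h1.symm.trans (Lp.coeFn_zero _ _ _)
  rw [hy0, tau_zero] at h2
  exact Lp.ext (h2.trans (Lp.coeFn_zero _ _ _).symm)

/-- The maximal operator `A_max y = τ_q(y)`, defined on all `y ∈ L²(ℝ)` with
`y, y' ∈ AC_loc(ℝ)` and `τ_q y ∈ L²(ℝ)`. -/
def maximalOperator (q : ℝ → ℝ) : L2R →ₗ.[ℂ] L2R := (maximalGraph q).toLinearPMap

theorem maximalOperator_graph (q : ℝ → ℝ) : (maximalOperator q).graph = maximalGraph q :=
  Submodule.toLinearPMap_graph_eq _ fun p hp h0 => maximalGraph_snd_eq_zero q p hp h0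

/-- The (classes of) functions `y` with `y, y' ∈ AC_loc(ℝ)` and compact support. -/
def compactlySupportedRegular : Submodule ℂ L2R where
  carrier := {f | ∃ y : ℝ → ℂ, IsRegular y ∧ HasCompactSupport y ∧ f =ᵐ[volume] y}
  zero_mem' := ⟨0, IsRegular.zero, HasCompactSupport.zero, Lp.coeFn_zero _ _ _⟩
  add_mem' := by
    rintro f g ⟨y, hy, hyc, h1⟩ ⟨w, hw, hwc, h2⟩
    exact ⟨y + w, hy.add hw, hyc.add hwc, (Lp.coeFn_add _ _).trans (h1.add h2)⟩
  smul_mem' := by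
    rintro c f ⟨y, hy, hyc, h1⟩
    exact ⟨c • y, hy.smul c, hyc.smul_left (f := fun _ => c),
      (Lp.coeFn_smul _ _).trans (h1.const_smul c)⟩

/-- The pre-minimal operator `A₀`: the restriction of the maximal operator to the functions of its
domain that have compact support. -/
def preminimalOperator (q : ℝ → ℝ) : L2R →ₗ.[ℂ] L2R :=
  (maximalOperator q).domRestrict compactlySupportedRegular

/-- The minimal operator `A`: the closure of the pre-minimal operator. -/
def minimalOperator (q : ℝ → ℝ) : L2R →ₗ.[ℂ] L2R := (preminimalOperator q).closure

end

end PTSymmetric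

/-!
Let `A` be a closed densely defined operator with `A ≤ A†` and `A ≤ B ≤ A†`. If `z` lies in the
resolvent set of `B`, then `B - z` is onto, so the orthogonal projection of its range onto
`ker (A† - conj z) = (ran (A - z))ᗮ` induces a surjection from `dom B / dom A`; dually, `B - z` is
injective, so `ker (A† - z)` embeds into `dom A† / dom B`. Hence, when all the spaces
`ker (A† - z)` have dimension `> r`, neither an `r`-dimensional bi-extension nor its adjoint has a
point in its resolvent set. Moreover `dim (dom A† / dom B†) = dim (dom B / dom A)`, since both
quotients are copies of the orthogonal complement of the graph of `A` in the graph of `B`.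

For the minimal operator in the limit circle case `ker (A† - z)` is two-dimensional for every `z`:
all solutions of `τ_q y = z y` are square integrable, and `A†` has no other eigenfunctions because
variation of constants produces a compactly supported solution of the inhomogeneous equation as
soon as the right hand side is orthogonal to the homogeneous solutions. Hence
`dim (dom A† / dom A) = 4` and `r = 1` is admissible. A `PT`-symmetric example is obtained by adding
to `dom A` one `PT`-invariant vector of `dom A†`.
-/

namespace PTSymmetric

open Filter Topology
open Complex (I)
open scoped BoundedContinuousFunction

/-! ### Extensions of partially defined linear maps -/

section PartialLinearMap

variable {R E F : Type*} [Ring R] [AddCommGroup E] [Module R E] [AddCommGroup F] [Module R F]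
  {S T : E →ₗ.[R] F}

theorem mem_graph_of_mem_domain_of_le (h : S ≤ T) {x : E} {y : F} (hx : x ∈ S.domain)
    (hxy : (x, y) ∈ T.graph) : (x, y) ∈ S.graph := by
  have hSx := S.mem_graph ⟨x, hx⟩
  rwa [T.mem_graph_snd_inj hxy (LinearPMap.le_graph_of_le h hSx) rfl]

theorem mem_graph_domRestrict_iff {V : Submodule R E} {x : E} {y : F} :
    (x, y) ∈ (T.domRestrict V).graph ↔ x ∈ V ∧ (x, y) ∈ T.graph := by
  refine ⟨fun h => ⟨(LinearPMap.mem_domain_of_mem_graph h).1,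
    LinearPMap.le_graph_of_le LinearPMap.domRestrict_le h⟩, fun ⟨hx, hxy⟩ => ?_⟩
  exact mem_graph_of_mem_domain_of_le LinearPMap.domRestrict_le
    ⟨hx, LinearPMap.mem_domain_of_mem_graph hxy⟩ hxy

theorem domain_domRestrict_of_le {V : Submodule R E} (hV : V ≤ T.domain) :
    (T.domRestrict V).domain = V := by
  rw [LinearPMap.domRestrict_domain, inf_eq_left.2 hV]

/-- The quotient `dom T / dom S` of the domain of an extension `T` of `S`, through which the
dimension of a bi-extension is measured. It is meaningful even when `S` is not a restriction of
`T`, `dom S` being replaced by its intersection with `dom T`. -/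
abbrev DomainQuotient (S T : E →ₗ.[R] F) : Type _ :=
  T.domain ⧸ S.domain.comap T.domain.subtype

end PartialLinearMap

section Closure

variable {R E F : Type*} [CommRing R] [AddCommGroup E] [AddCommGroup F] [Module R E] [Module R F]
  [TopologicalSpace E] [TopologicalSpace F] [ContinuousAdd E] [ContinuousAdd F]
  [TopologicalSpace R] [ContinuousSMul R E] [ContinuousSMul R F] {S T : E →ₗ.[R] F}

theorem closure_le_of_isClosed (hT : T.IsClosed) (hST : S ≤ T) :
    S.closure ≤ T := by
  refine LinearPMap.le_of_le_graph ?_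
  rw [← (hT.isClosable.leIsClosable hST).graph_closure_eq_closure_graph]
  exact Submodule.topologicalClosure_minimal _ (LinearPMap.le_graph_of_le hST) hT

end Closure

section DomainQuotientRank

variable {K E F : Type*} [DivisionRing K] [AddCommGroup E] [Module K E] [AddCommGroup F]
  [Module K F] {S T U : E →ₗ.[K] F}

theorem rank_domainQuotient_add_rank_domainQuotient (hST : S ≤ T) (hTU : T ≤ U) :
    Module.rank K (DomainQuotient T U) + Module.rank K (DomainQuotient S T) =
      Module.rank K (DomainQuotient S U) := by
  let s := S.domain.comap U.domain.subtype
  let t := T.domain.comap U.domain.subtype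
  have hst : s ≤ t := Submodule.comap_mono hST.1
  let ι : T.domain →ₗ[K] U.domain ⧸ s := s.mkQ ∘ₗ Submodule.inclusion hTU.1
  have hker : LinearMap.ker ι = S.domain.comap T.domain.subtype := by
    rw [LinearMap.ker_comp, Submodule.ker_mkQ, ← Submodule.comap_comp]
    rfl
  have hrange : LinearMap.range ι = t.map s.mkQ := by
    rw [LinearMap.range_comp, Submodule.range_inclusion]
  have hbot : Module.rank K (DomainQuotient S T) = Module.rank K (t.map s.mkQ) := by
    rw [← ((Submodule.quotEquivOfEq _ _ hker).symm.trans ι.quotKerEquivRange).symm.rank_eq, hrange]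
  rw [hbot, ← (Submodule.quotientQuotientEquivQuotient s t hst).rank_eq]
  exact Submodule.rank_quotient_add_rank _

theorem rank_domainQuotient_of_domain_le (h : T.domain ≤ S.domain) :
    Module.rank K (DomainQuotient S T) = 0 := by
  unfold DomainQuotient
  rw [Submodule.comap_subtype_eq_top.2 h, rank_subsingleton']

theorem rank_domainQuotient_domRestrict_sup {V : Submodule K E} (hST : S ≤ T)
    (hV : V ≤ T.domain) (hdisj : Disjoint V S.domain) :
    Module.rank K (DomainQuotient S (T.domRestrict (S.domain ⊔ V))) = Module.rank K V := by
  have hinf : (V ⊓ S.domain).comap V.subtype = ⊥ := by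
    rw [hdisj.eq_bot, Submodule.comap_bot, Submodule.ker_subtype]
  unfold DomainQuotient
  rw [domain_domRestrict_of_le (sup_le hST.1 hV), sup_comm,
    ← (LinearMap.quotientInfEquivSupQuotient V S.domain).rank_eq]
  exact (Submodule.quotEquivOfEqBot _ hinf).rank_eq

end DomainQuotientRank

section Adjoint

variable {𝕜 E F : Type*} [RCLike 𝕜] [NormedAddCommGroup E] [InnerProductSpace 𝕜 E]
  [NormedAddCommGroup F] [InnerProductSpace 𝕜 F] [CompleteSpace E] {A B : E →ₗ.[𝕜] F}

theorem mem_graph_adjoint_iff (hA : Dense (A.domain : Set E)) {x : F} {y : E} :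
    (x, y) ∈ A†.graph ↔ ∀ a b, (a, b) ∈ A.graph → inner 𝕜 b x = inner 𝕜 a y := by
  rw [LinearPMap.adjoint_graph_eq_graph_adjoint hA, Submodule.mem_adjoint_iff]
  simp only [sub_eq_zero]

theorem adjoint_le_adjoint (hA : Dense (A.domain : Set E)) (h : A ≤ B) : B† ≤ A† := by
  refine LinearPMap.le_of_le_graph fun ⟨x, y⟩ hxy => ?_
  rw [mem_graph_adjoint_iff (hA.mono h.1)] at hxy
  exact (mem_graph_adjoint_iff hA).2 fun a b hab => hxy a b (LinearPMap.le_graph_of_le h hab)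

theorem le_adjoint_of_le_adjoint [CompleteSpace F] {A : E →ₗ.[𝕜] F} {B : F →ₗ.[𝕜] E}
    (hA : Dense (A.domain : Set E)) (hB : Dense (B.domain : Set F)) (h : B ≤ A†) : A ≤ B† := by
  refine LinearPMap.le_of_le_graph fun ⟨a, b⟩ hab =>
    (mem_graph_adjoint_iff hB).2 fun x y hxy => ?_
  have hxy' := (mem_graph_adjoint_iff hA).1 (LinearPMap.le_graph_of_le h hxy) a b hab
  rw [← inner_conj_symm, ← hxy', inner_conj_symm]

theorem adjoint_closure (hA : Dense (A.domain : Set E)) (hcl : A.IsClosable) :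
    A.closure† = A† := by
  refine le_antisymm (adjoint_le_adjoint hA A.le_closure)
    (LinearPMap.le_of_le_graph fun ⟨x, y⟩ hxy => ?_)
  refine (mem_graph_adjoint_iff (hA.mono A.le_closure.1)).2 fun a b hab => ?_
  rw [← hcl.graph_closure_eq_closure_graph] at hab
  have hclosed : IsClosed {p : E × F | inner 𝕜 p.2 x = inner 𝕜 p.1 y} :=
    isClosed_eq (by fun_prop) (by fun_prop)
  exact closure_minimal (fun p hp => (mem_graph_adjoint_iff hA).1 hxy p.1 p.2 hp) hclosed hab

/-- The orthogonal complement of the graph of `A` inside the graph of an extension `B`, which is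
isomorphic both to `dom B / dom A` and to `dom A† / dom B†`. For densely defined `A`, a pair
`(x, y)` is orthogonal to the graph of `A` iff `(y, -x)` lies in the graph of `A†`. -/
noncomputable def graphComplement (A B : E →ₗ.[𝕜] F) : Submodule 𝕜 (E × F) :=
  B.graph ⊓ A†.graph.comap ((LinearMap.snd 𝕜 E F).prod (-LinearMap.fst 𝕜 E F))

theorem mem_graphComplement_iff {x : E} {y : F} :
    (x, y) ∈ graphComplement A B ↔ (x, y) ∈ B.graph ∧ (y, -x) ∈ A†.graph := Iff.rfl

theorem eq_zero_of_mem_graph_of_mem_graph_adjoint (hA : Dense (A.domain : Set E)) {x : E} {y : F}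
    (hxy : (x, y) ∈ A.graph) (hyx : (y, -x) ∈ A†.graph) : (x, y) = 0 := by
  have h := (mem_graph_adjoint_iff hA).1 hyx x y hxy
  rw [inner_neg_right, inner_self_eq_norm_sq_to_K, inner_self_eq_norm_sq_to_K] at h
  have h' : ‖y‖ ^ 2 = -‖x‖ ^ 2 := by exact_mod_cast h
  have hx : ‖x‖ = 0 := by nlinarith [sq_nonneg ‖x‖, sq_nonneg ‖y‖]
  have hy : ‖y‖ = 0 := by nlinarith [sq_nonneg ‖x‖, sq_nonneg ‖y‖]
  rw [norm_eq_zero.1 hx, norm_eq_zero.1 hy, Prod.mk_zero_zero]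

theorem exists_add_of_isClosed [CompleteSpace F] (hA : Dense (A.domain : Set E))
    (hcl : A.IsClosed) (x : E) (y : F) :
    ∃ a b c d, (a, b) ∈ A.graph ∧ (d, -c) ∈ A†.graph ∧ x = a + c ∧ y = b + d := by
  let e := WithLp.prodContinuousLinearEquiv 2 𝕜 E F
  let G : Submodule 𝕜 (WithLp 2 (E × F)) := A.graph.comap e.toLinearMap
  have hG : IsClosed (G : Set (WithLp 2 (E × F))) := hcl.preimage e.continuous
  have : CompleteSpace G := hG.completeSpace_coe
  obtain ⟨g, hg, p, hp, hgp⟩ := G.exists_add_mem_mem_orthogonal (WithLp.toLp 2 (x, y))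
  refine ⟨g.fst, g.snd, p.fst, p.snd, hg, ?_, congrArg WithLp.fst hgp, congrArg WithLp.snd hgp⟩
  refine (mem_graph_adjoint_iff hA).2 fun a b hab => ?_
  have h := (Submodule.mem_orthogonal _ _).1 hp (WithLp.toLp 2 (a, b)) hab
  rw [WithLp.prod_inner_apply] at h
  rw [inner_neg_right]
  exact eq_neg_of_add_eq_zero_right h

theorem nonempty_graphComplement_equiv_domainQuotient [CompleteSpace F]
    (hA : Dense (A.domain : Set E)) (hcl : A.IsClosed) (hAB : A ≤ B) :
    Nonempty (graphComplement A B ≃ₗ[𝕜] DomainQuotient A B) := by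
  let π : graphComplement A B →ₗ[𝕜] B.domain :=
    ((LinearMap.fst 𝕜 E F).domRestrict _).codRestrict B.domain
      fun p => LinearPMap.mem_domain_of_mem_graph p.2.1
  let S := A.domain.comap B.domain.subtype
  let f := S.mkQ ∘ₗ π
  refine ⟨LinearEquiv.ofBijective f ⟨?_, ?_⟩⟩
  · refine (injective_iff_map_eq_zero f).2 fun ⟨⟨x, y⟩, hxy, hyx⟩ h => Subtype.ext ?_
    have hx : x ∈ A.domain := (Submodule.Quotient.mk_eq_zero S).1 h
    exact eq_zero_of_mem_graph_of_mem_graph_adjoint hA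
      (mem_graph_of_mem_domain_of_le hAB hx hxy) hyx
  · intro c
    obtain ⟨x, rfl⟩ := S.mkQ_surjective c
    obtain ⟨a, b, c, d, hab, hdc, hx, hy⟩ := exists_add_of_isClosed hA hcl (x : E) (B x)
    have hcd : (c, d) ∈ B.graph := by
      rw [show (c, d) = (↑x, B x) - (a, b) by rw [hx, hy]; simp]
      exact B.graph.sub_mem (B.mem_graph x) (LinearPMap.le_graph_of_le hAB hab)
    refine ⟨⟨(c, d), hcd, hdc⟩, (Submodule.Quotient.eq S).2 ?_⟩
    change c - x ∈ A.domain
    rw [hx, show c - (a + c) = -a by abel]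
    exact A.domain.neg_mem (LinearPMap.mem_domain_of_mem_graph hab)

theorem nonempty_graphComplement_equiv_domainQuotient_adjoint [CompleteSpace F]
    (hA : Dense (A.domain : Set E)) (hB : B.IsClosed) (hAB : A ≤ B) :
    Nonempty (graphComplement A B ≃ₗ[𝕜] DomainQuotient B† A†) := by
  let π : graphComplement A B →ₗ[𝕜] A†.domain :=
    ((LinearMap.snd 𝕜 E F).domRestrict _).codRestrict A†.domain
      fun p => LinearPMap.mem_domain_of_mem_graph p.2.2
  have hBA := adjoint_le_adjoint hA hAB
  have hBdense := hA.mono hAB.1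
  let S := B†.domain.comap A†.domain.subtype
  let f := S.mkQ ∘ₗ π
  refine ⟨LinearEquiv.ofBijective f ⟨?_, ?_⟩⟩
  · refine (injective_iff_map_eq_zero f).2 fun ⟨⟨x, y⟩, hxy, hyx⟩ h => Subtype.ext ?_
    have hy : y ∈ B†.domain := (Submodule.Quotient.mk_eq_zero S).1 h
    exact eq_zero_of_mem_graph_of_mem_graph_adjoint hBdense hxy
      (mem_graph_of_mem_domain_of_le hBA hy hyx)
  · intro c
    obtain ⟨y, rfl⟩ := S.mkQ_surjective c
    obtain ⟨a, b, c, d, hab, hdc, hx, hy⟩ := exists_add_of_isClosed hBdense hB (-A† y) (y : F)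
    have hba : (b, -a) ∈ A†.graph := by
      rw [show (b, -a) = (↑y, A† y) - (d, -c) by rw [hy, ← neg_neg (A† y), hx]; simp]
      exact A†.graph.sub_mem (A†.mem_graph y) (LinearPMap.le_graph_of_le hBA hdc)
    refine ⟨⟨(a, b), hab, hba⟩, (Submodule.Quotient.eq S).2 ?_⟩
    change b - y ∈ B†.domain
    rw [hy, show b - (b + d) = -d by abel]
    exact B†.domain.neg_mem (LinearPMap.mem_domain_of_mem_graph hdc)

end Adjoint

/-! ### Bi-extensions and deficiency spaces -/

section Deficiency

variable {𝕜 H : Type*} [RCLike 𝕜] [NormedAddCommGroup H] [InnerProductSpace 𝕜 H]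
  [CompleteSpace H] {A : H →ₗ.[𝕜] H}

/-- The deficiency space `ker (A† - z)`, described through the graph of `A†` so that membership in
`dom A†` is part of the condition. -/
noncomputable def deficiencySpace (A : H →ₗ.[𝕜] H) (z : 𝕜) : Submodule 𝕜 H :=
  A†.graph.comap (LinearMap.id.prod (z • LinearMap.id))

theorem mem_deficiencySpace_iff {z : 𝕜} {x : H} :
    x ∈ deficiencySpace A z ↔ (x, z • x) ∈ A†.graph := Iff.rfl

theorem isClosed_deficiencySpace (hA : Dense (A.domain : Set H)) (z : 𝕜) :
    IsClosed (deficiencySpace A z : Set H) :=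
  (LinearPMap.adjoint_isClosed hA).preimage (continuous_id.prodMk (continuous_const_smul z))

end Deficiency

section BiExtension

variable {H : Type*} [NormedAddCommGroup H] [InnerProductSpace ℂ H] [CompleteSpace H]
  {A B : H →ₗ.[ℂ] H}

theorem mk_smul_mem_graphComplement_adjoint {c : ℂ} (hc : c * c = -1) {u : H}
    (hu : u ∈ deficiencySpace A c) : (u, c • u) ∈ graphComplement A A† := by
  refine mem_graphComplement_iff.2 ⟨hu, ?_⟩
  have h := A†.graph.smul_mem c (mem_deficiencySpace_iff.1 hu)
  rwa [Prod.smul_mk, smul_smul, hc, neg_one_smul] at h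

theorem half_smul_mem_deficiencySpace {c : ℂ} (hc : c * c = -1) {x y : H}
    (hxy : (x, y) ∈ graphComplement A A†) :
    (1 / 2 : ℂ) • (x - c • y) ∈ deficiencySpace A c := by
  obtain ⟨hx, hy⟩ := mem_graphComplement_iff.1 hxy
  refine Submodule.smul_mem _ _ (mem_deficiencySpace_iff.2 ?_)
  convert A†.graph.sub_mem hx (A†.graph.smul_mem c hy) using 1
  simp [smul_sub, smul_smul, hc, add_comm]

/-- Von Neumann's decomposition: the map `(x, y) ↦ (y, -x)` preserves the complement of the graph of
`A` and has square `-1`, and its eigenspaces for `±I` are the deficiency spaces at `±I`. -/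
theorem nonempty_deficiencySpace_prod_equiv :
    Nonempty ((deficiencySpace A I × deficiencySpace A (-I)) ≃ₗ[ℂ] graphComplement A A†) := by
  have hI := Complex.I_mul_I
  have hI' : -I * -I = -1 := by rw [neg_mul_neg, hI]
  let ι (c : ℂ) (hc : c * c = -1) : deficiencySpace A c →ₗ[ℂ] graphComplement A A† :=
    ((LinearMap.id.prod (c • LinearMap.id)).domRestrict _).codRestrict _
      fun u => by simpa using mk_smul_mem_graphComplement_adjoint hc u.2
  let f := (ι I hI).coprod (ι (-I) hI')
  refine ⟨LinearEquiv.ofBijective f ⟨?_, ?_⟩⟩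
  · refine (injective_iff_map_eq_zero f).2 fun ⟨⟨u, hu⟩, ⟨w, hw⟩⟩ h => ?_
    have hadd : u + w = 0 := congrArg (fun p : graphComplement A A† => p.1.1) h
    have hsub : I • u + -I • w = 0 := congrArg (fun p : graphComplement A A† => p.1.2) h
    obtain rfl := eq_neg_of_add_eq_zero_right hadd
    have hu0 : (2 * I) • u = 0 := by rw [← hsub]; module
    obtain rfl : u = 0 := (smul_eq_zero.1 hu0).resolve_left (by simp)
    simp
  · rintro ⟨⟨x, y⟩, hxy⟩
    refine ⟨(⟨_, half_smul_mem_deficiencySpace hI hxy⟩,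
      ⟨_, half_smul_mem_deficiencySpace hI' hxy⟩), Subtype.ext (Prod.ext ?_ ?_)⟩
    · change (1 / 2 : ℂ) • (x - I • y) + (1 / 2 : ℂ) • (x - -I • y) = x
      module
    · change I • (1 / 2 : ℂ) • (x - I • y) + -I • (1 / 2 : ℂ) • (x - -I • y) = y
      match_scalars
      · ring
      · linear_combination -hI

theorem rank_domainQuotient_adjoint (hA : Dense (A.domain : Set H)) (hcl : A.IsClosed)
    (hsymm : A ≤ A†) :
    Module.rank ℂ (DomainQuotient A A†) =
      Module.rank ℂ (deficiencySpace A I) + Module.rank ℂ (deficiencySpace A (-I)) := by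
  obtain ⟨e⟩ := nonempty_graphComplement_equiv_domainQuotient hA hcl hsymm
  obtain ⟨e'⟩ := nonempty_deficiencySpace_prod_equiv (A := A)
  rw [← (e'.trans e).rank_eq, rank_prod']

theorem rank_domainQuotient_adjoint_adjoint (hA : Dense (A.domain : Set H)) (hcl : A.IsClosed)
    (hBcl : B.IsClosed) (hAB : A ≤ B) :
    Module.rank ℂ (DomainQuotient B† A†) = Module.rank ℂ (DomainQuotient A B) := by
  obtain ⟨e⟩ := nonempty_graphComplement_equiv_domainQuotient hA hcl hAB
  obtain ⟨e'⟩ := nonempty_graphComplement_equiv_domainQuotient_adjoint hA hBcl hAB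
  exact (e'.symm.trans e).rank_eq

theorem IsBiExtensionOfDim.adjoint {n r : ℕ} (hA : Dense (A.domain : Set H)) (hcl : A.IsClosed)
    (hdim : Module.rank ℂ (DomainQuotient A A†) = ((n + r : ℕ) : Cardinal))
    (hB : IsBiExtensionOfDim A B r) : IsBiExtensionOfDim A B† n := by
  obtain ⟨⟨hBcl, hAB, hBA⟩, hr⟩ := hB
  have hBdense := hA.mono hAB.1
  have hAB' : A ≤ B† := le_adjoint_of_le_adjoint hA hBdense hBA
  have hBA' : B† ≤ A† := adjoint_le_adjoint hA hAB
  refine ⟨⟨LinearPMap.adjoint_isClosed hBdense, hAB', hBA'⟩, ?_⟩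
  have hadd := rank_domainQuotient_add_rank_domainQuotient hAB' hBA'
  rwa [rank_domainQuotient_adjoint_adjoint hA hcl hBcl hAB, hr, hdim, add_comm, Nat.cast_add,
    Cardinal.add_nat_inj] at hadd

theorem rank_deficiencySpace_conj_le_of_mem_resolventSet (hA : Dense (A.domain : Set H))
    (hAB : A ≤ B) {z : ℂ} (hz : z ∈ resolventSet B) :
    Module.rank ℂ (deficiencySpace A (star z)) ≤ Module.rank ℂ (DomainQuotient A B) := by
  obtain ⟨R, hR, -⟩ := hz
  let N := deficiencySpace A (star z)
  have : CompleteSpace N := (isClosed_deficiencySpace hA _).completeSpace_coe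
  let S := A.domain.comap B.domain.subtype
  let P : B.domain →ₗ[ℂ] N :=
    N.orthogonalProjectionOnto.toLinearMap ∘ₗ (B.toFun - z • B.domain.subtype)
  have hP : ∀ b, P b = N.orthogonalProjectionOnto (B b - z • (b : H)) := fun _ => rfl
  have hSP : S ≤ LinearMap.ker P := by
    intro a ha
    rw [LinearMap.mem_ker, hP, Submodule.orthogonalProjectionOnto_eq_zero_iff]
    refine (Submodule.mem_orthogonal' _ _).2 fun u hu => ?_
    have hgraph := mem_graph_of_mem_domain_of_le hAB ha (B.mem_graph a)
    have h := (mem_graph_adjoint_iff hA).1 (mem_deficiencySpace_iff.1 hu) _ _ hgraph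
    rw [inner_sub_left, h, inner_smul_left, inner_smul_right]
    exact sub_self _
  refine LinearMap.rank_le_of_surjective (S.liftQ P hSP) fun u => ?_
  obtain ⟨hu, hBu⟩ := hR u
  refine ⟨S.mkQ ⟨R u, hu⟩, ?_⟩
  rw [Submodule.mkQ_apply, Submodule.liftQ_apply, hP, hBu,
    Submodule.orthogonalProjectionOnto_mem_subspace_eq_self]

theorem rank_deficiencySpace_le_of_mem_resolventSet (hBA : B ≤ A†) {z : ℂ}
    (hz : z ∈ resolventSet B) :
    Module.rank ℂ (deficiencySpace A z) ≤ Module.rank ℂ (DomainQuotient B A†) := by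
  obtain ⟨R, -, hR⟩ := hz
  let S := B.domain.comap A†.domain.subtype
  have hle : deficiencySpace A z ≤ A†.domain := fun _ => LinearPMap.mem_domain_of_mem_graph
  refine LinearMap.rank_le_of_injective (S.mkQ ∘ₗ Submodule.inclusion hle)
    ((injective_iff_map_eq_zero _).2 fun u hu => Subtype.ext ?_)
  have huB : (u : H) ∈ B.domain := (Submodule.Quotient.mk_eq_zero S).1 hu
  have hzu : z • (u : H) = B ⟨u, huB⟩ := (LinearPMap.image_iff huB).2
    (mem_graph_of_mem_domain_of_le hBA huB (mem_deficiencySpace_iff.1 u.2))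
  have hRu : R (B ⟨u, huB⟩ - z • (u : H)) = u := hR ⟨u, huB⟩
  rw [← hRu, hzu, sub_self, map_zero]
  rfl

theorem IsBiExtensionOfDim.resolventSet_eq_empty {r : ℕ} (hA : Dense (A.domain : Set H))
    (hdef : ∀ z, (r : Cardinal) < Module.rank ℂ (deficiencySpace A z))
    (hB : IsBiExtensionOfDim A B r) : resolventSet B = ∅ :=
  eq_empty_of_forall_notMem fun z hz => (hdef (star z)).not_ge <|
    (rank_deficiencySpace_conj_le_of_mem_resolventSet hA hB.1.2.1 hz).trans_eq hB.2

theorem IsBiExtensionOfDim.resolventSet_adjoint_eq_empty {r : ℕ} (hA : Dense (A.domain : Set H))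
    (hcl : A.IsClosed) (hdef : ∀ z, (r : Cardinal) < Module.rank ℂ (deficiencySpace A z))
    (hB : IsBiExtensionOfDim A B r) : resolventSet B† = ∅ := by
  obtain ⟨⟨hBcl, hAB, -⟩, hr⟩ := hB
  refine eq_empty_of_forall_notMem fun z hz => (hdef z).not_ge ?_
  exact (rank_deficiencySpace_le_of_mem_resolventSet (adjoint_le_adjoint hA hAB) hz).trans_eq
    ((rank_domainQuotient_adjoint_adjoint hA hcl hBcl hAB).trans hr)

theorem isBiExtensionOfDim_domRestrict_sup (hcl : A.IsClosed) (hsymm : A ≤ A†) {V : Submodule ℂ H}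
    [FiniteDimensional ℂ V] (hV : V ≤ A†.domain) (hdisj : Disjoint V A.domain) :
    IsBiExtensionOfDim A (A†.domRestrict (A.domain ⊔ V)) (Module.finrank ℂ V) := by
  have hAB : A ≤ A†.domRestrict (A.domain ⊔ V) := LinearPMap.le_of_le_graph fun ⟨a, b⟩ hab =>
    mem_graph_domRestrict_iff.2 ⟨Submodule.mem_sup_left (LinearPMap.mem_domain_of_mem_graph hab),
      LinearPMap.le_graph_of_le hsymm hab⟩
  refine ⟨⟨?_, hAB, LinearPMap.domRestrict_le⟩, ?_⟩
  · let W : Submodule ℂ (H × H) :=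
      LinearMap.range (V.subtype.prod (A†.toFun ∘ₗ Submodule.inclusion hV))
    have hgraph : (A†.domRestrict (A.domain ⊔ V)).graph = A.graph ⊔ W := by
      refine le_antisymm ?_ (sup_le (LinearPMap.le_graph_of_le hAB) ?_)
      · rintro ⟨x, y⟩ hxy
        obtain ⟨hx, hxy⟩ := mem_graph_domRestrict_iff.1 hxy
        obtain ⟨a, ha, v, hv, rfl⟩ := Submodule.mem_sup.1 hx
        have hvW : (v, A† ⟨v, hV hv⟩) ∈ W := ⟨⟨v, hv⟩, rfl⟩
        have hva := A†.graph.sub_mem hxy (A†.mem_graph ⟨v, hV hv⟩)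
        simp only [Prod.mk_sub_mk, add_sub_cancel_right] at hva
        refine Submodule.mem_sup.2 ⟨_, mem_graph_of_mem_domain_of_le hsymm ha hva, _, hvW, ?_⟩
        simp
      · rintro _ ⟨v, rfl⟩
        exact mem_graph_domRestrict_iff.2 ⟨Submodule.mem_sup_right v.2,
          A†.mem_graph ⟨v, hV v.2⟩⟩
    rw [LinearPMap.IsClosed, hgraph]
    exact Submodule.isClosed_sup_finiteDimensional _ _ hcl
  · rw [Module.finrank_eq_rank]
    exact rank_domainQuotient_domRestrict_sup hsymm hV hdisj

end BiExtension

/-! ### Operators commuting with a conjugation -/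

section Conjugation

variable {H : Type*} [NormedAddCommGroup H] [InnerProductSpace ℂ H]

/-- The map `C`, in practice an antilinear conjugation, leaves the domain of `T` invariant and
commutes with `T` there. For conjugations such operators are called `C`-real. -/
def CommutesWith (C : H → H) (T : H →ₗ.[ℂ] H) : Prop :=
  ∀ x y, (x, y) ∈ T.graph → (C x, C y) ∈ T.graph

variable {A T : H →ₗ.[ℂ] H}

theorem CommutesWith.closure {C : H → H} (hC : Continuous C) (hT : T.IsClosable)
    (hCT : CommutesWith C T) : CommutesWith C T.closure := by
  have hmaps : MapsTo (Prod.map C C) T.graph T.graph := fun p hp => hCT p.1 p.2 hp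
  intro x y hxy
  rw [← hT.graph_closure_eq_closure_graph] at hxy ⊢
  exact map_mem_closure (f := Prod.map C C) (hC.prodMap hC) hxy hmaps

theorem CommutesWith.domRestrict {C : H → H} {V : Submodule ℂ H} (hCT : CommutesWith C T)
    (hV : ∀ v ∈ V, C v ∈ V) : CommutesWith C (T.domRestrict V) := by
  intro x y hxy
  obtain ⟨hx, hxy⟩ := mem_graph_domRestrict_iff.1 hxy
  exact mem_graph_domRestrict_iff.2 ⟨hV x hx, hCT x y hxy⟩

theorem CommutesWith.map_mem_domain {C : H → H} (hCT : CommutesWith C T) {x : H}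
    (hx : x ∈ T.domain) : C x ∈ T.domain :=
  LinearPMap.mem_domain_of_mem_graph (hCT _ _ (T.mem_graph ⟨x, hx⟩))

theorem inner_conjugation_map_map (C : H →ₗᵢ⋆[ℂ] H) (x y : H) :
    inner ℂ (C x) (C y) = inner ℂ y x := by
  have hnormI : ∀ z : H, ‖I • z‖ = ‖z‖ := fun z => by rw [norm_smul]; simp
  have hadd : ‖C x + C y‖ = ‖y + x‖ := by rw [← map_add, C.norm_map, add_comm]
  have hsub : ‖C x - C y‖ = ‖y - x‖ := by rw [← map_sub, C.norm_map, norm_sub_rev]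
  have hsubI : ‖C x - I • C y‖ = ‖y - I • x‖ :=
    calc ‖C x - I • C y‖ = ‖C (x + I • y)‖ := by simp [map_smulₛₗ, sub_eq_add_neg]
      _ = ‖x + I • y‖ := C.norm_map _
      _ = ‖I • (y - I • x)‖ := by simp [smul_sub, smul_smul, add_comm]
      _ = ‖y - I • x‖ := hnormI _
  have haddI : ‖C x + I • C y‖ = ‖y + I • x‖ :=
    calc ‖C x + I • C y‖ = ‖C (x - I • y)‖ := by simp [map_smulₛₗ]
      _ = ‖x - I • y‖ := C.norm_map _
      _ = ‖I • (y + I • x)‖ := by rw [norm_sub_rev]; simp [smul_smul, sub_eq_add_neg]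
      _ = ‖y + I • x‖ := hnormI _
  rw [inner_eq_sum_norm_sq_div_four, inner_eq_sum_norm_sq_div_four]
  simp only [RCLike.I_to_complex, hadd, hsub, hsubI, haddI]

theorem CommutesWith.adjoint [CompleteSpace H] (C : H →ₗᵢ⋆[ℂ] H) (hC : Function.Involutive C)
    (hT : Dense (T.domain : Set H)) (hCT : CommutesWith C T) : CommutesWith C T† := by
  intro x y hxy
  refine (mem_graph_adjoint_iff hT).2 fun a b hab => ?_
  have h := (mem_graph_adjoint_iff hT).1 hxy _ _ (hCT a b hab)
  rw [← inner_conjugation_map_map C x, ← inner_conjugation_map_map C y, hC, hC] at h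
  rw [← inner_conj_symm, h, inner_conj_symm]

theorem exists_fixed_notMem_of_lt {M : Type*} [AddCommGroup M] [Module ℂ M] {C : M →ₗ⋆[ℂ] M}
    (hC : Function.Involutive C) {V W : Submodule ℂ M} (hVW : V < W) (hW : ∀ w ∈ W, C w ∈ W) :
    ∃ v ∈ W, v ∉ V ∧ C v = v := by
  obtain ⟨w, hwW, hwV⟩ := SetLike.exists_of_lt hVW
  by_cases hadd : w + C w ∈ V
  · refine ⟨I • (w - C w), W.smul_mem _ (W.sub_mem hwW (hW w hwW)), fun hsub => hwV ?_, ?_⟩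
    · have h := V.smul_mem (1 / 2 : ℂ) (V.sub_mem hadd (V.smul_mem I hsub))
      convert h using 1
      match_scalars
      · linear_combination (1 / 2 : ℂ) * Complex.I_mul_I
      · linear_combination -(1 / 2 : ℂ) * Complex.I_mul_I
    · rw [map_smulₛₗ, map_sub, hC w, Complex.conj_I]
      module
  · exact ⟨w + C w, W.add_mem hwW (hW w hwW), hadd, by rw [map_add, hC w, add_comm]⟩

theorem exists_isBiExtensionOfDim_one_commutesWith [CompleteSpace H] (C : H →ₗᵢ⋆[ℂ] H)
    (hC : Function.Involutive C) (hA : Dense (A.domain : Set H)) (hcl : A.IsClosed)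
    (hsymm : A ≤ A†) (hne : A.domain ≠ A†.domain) (hCA : CommutesWith C A) :
    ∃ B, IsBiExtensionOfDim A B 1 ∧ CommutesWith C B := by
  have hCadj := hCA.adjoint C hC hA
  obtain ⟨v, hvadj, hvA, hCv⟩ := exists_fixed_notMem_of_lt (C := C.toLinearMap) hC
    (hsymm.1.lt_of_ne hne) fun _ => hCadj.map_mem_domain
  have hv0 : v ≠ 0 := fun h => hvA (h ▸ A.domain.zero_mem)
  have hspan : Submodule.span ℂ {v} ≤ A†.domain := (Submodule.span_singleton_le_iff_mem _ _).2 hvadj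
  have hdisj : Disjoint (Submodule.span ℂ {v}) A.domain :=
    (Submodule.disjoint_span_singleton' hv0).2 hvA |>.symm
  refine ⟨A†.domRestrict (A.domain ⊔ Submodule.span ℂ {v}), ?_, hCadj.domRestrict fun x hx => ?_⟩
  · simpa only [finrank_span_singleton hv0] using
      isBiExtensionOfDim_domRestrict_sup hcl hsymm hspan hdisj
  · obtain ⟨a, ha, u, hu, rfl⟩ := Submodule.mem_sup.1 hx
    obtain ⟨c, rfl⟩ := Submodule.mem_span_singleton.1 hu
    rw [map_add, map_smulₛₗ, show C v = v from hCv]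
    exact Submodule.add_mem_sup (hCA.map_mem_domain ha)
      (Submodule.smul_mem _ _ (Submodule.mem_span_singleton_self v))

end Conjugation

/-! ### Locally absolutely continuous functions -/

section AbsoluteContinuity

theorem absolutelyContinuousOnInterval_of_dist_le {X Y : Type*} [PseudoMetricSpace X]
    [PseudoMetricSpace Y] {f : ℝ → X} {g : ℝ → Y} {a b : ℝ} (K : ℝ)
    (hg : AbsolutelyContinuousOnInterval g a b)
    (h : ∀ x ∈ uIcc a b, ∀ y ∈ uIcc a b, dist (f x) (f y) ≤ K * dist (g x) (g y)) :
    AbsolutelyContinuousOnInterval f a b := by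
  unfold AbsolutelyContinuousOnInterval at hg ⊢
  refine squeeze_zero' (Eventually.of_forall fun _ => Finset.sum_nonneg fun _ _ => dist_nonneg) ?_
    (by simpa using hg.const_mul K)
  rw [eventually_inf_principal]
  refine Eventually.of_forall fun E hE => ?_
  rw [Finset.mul_sum]
  exact Finset.sum_le_sum fun i hi => h _ (hE.1 i hi).1 _ (hE.1 i hi).2

theorem absolutelyContinuousOnInterval_comp_of_locallyLipschitz {E X : Type*}
    [SeminormedAddCommGroup E] [PseudoMetricSpace X] {φ : E → X} {f : ℝ → E} {a b : ℝ}
    (hφ : LocallyLipschitz φ) (hf : AbsolutelyContinuousOnInterval f a b) :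
    AbsolutelyContinuousOnInterval (fun x => φ (f x)) a b := by
  have hcompact : IsCompact (f '' uIcc a b) :=
    isCompact_uIcc.image_of_continuousOn hf.continuousOn
  obtain ⟨K, hK⟩ := hφ.locallyLipschitzOn.exists_lipschitzOnWith_of_compact hcompact
  exact absolutelyContinuousOnInterval_of_dist_le K hf fun x hx y hy =>
    hK.dist_le_mul _ (mem_image_of_mem f hx) _ (mem_image_of_mem f hy)

theorem absolutelyContinuousOnInterval_comp_neg {X : Type*} [PseudoMetricSpace X]
    {f : ℝ → X} {a b : ℝ} (hf : AbsolutelyContinuousOnInterval f (-a) (-b)) :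
    AbsolutelyContinuousOnInterval (fun x => f (-x)) a b := by
  rw [absolutelyContinuousOnInterval_iff] at hf ⊢
  intro ε hε
  obtain ⟨δ, hδ, h⟩ := hf ε hε
  have hmem : ∀ x ∈ uIcc a b, -x ∈ uIcc (-a) (-b) := fun x hx => by
    rw [mem_uIcc] at hx ⊢
    grind
  refine ⟨δ, hδ, fun E hE hlen => h (E.1, fun i => (-(E.2 i).1, -(E.2 i).2)) ⟨fun i hi =>
    ⟨hmem _ (hE.1 i hi).1, hmem _ (hE.1 i hi).2⟩, fun i hi j hj hij => ?_⟩ ?_⟩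
  · have hdisj := hE.2 hi hj hij
    simp only [Function.onFun, uIoc, Ioc_disjoint_Ioc, max_neg_neg, min_neg_neg, neg_le_neg_iff]
      at hdisj ⊢
    exact hdisj
  · simpa only [dist_neg_neg] using hlen

theorem intervalIntegrable_of_locallyIntegrable {E : Type*} [NormedAddCommGroup E] {f : ℝ → E}
    (hf : LocallyIntegrable f) (a b : ℝ) : IntervalIntegrable f volume a b :=
  intervalIntegrable_iff.mpr
    ((hf.integrableOn_isCompact isCompact_uIcc).mono_set uIoc_subset_uIcc)

theorem absolutelyContinuousOnInterval_intervalIntegral {E : Type*} [NormedAddCommGroup E]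
    [NormedSpace ℝ E] {f : ℝ → E} (hf : LocallyIntegrable f) (c a b : ℝ) :
    AbsolutelyContinuousOnInterval (fun x => ∫ t in c..x, f t) a b := by
  have hi := intervalIntegrable_of_locallyIntegrable hf
  refine absolutelyContinuousOnInterval_of_dist_le 1
    ((hi a b).norm.absolutelyContinuousOnInterval_intervalIntegral left_mem_uIcc)
    fun x _ y _ => ?_
  rw [one_mul, dist_eq_norm, Real.dist_eq, intervalIntegral.integral_interval_sub_left (hi _ _)
    (hi _ _), intervalIntegral.integral_interval_sub_left (hi _ _).norm (hi _ _).norm]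
  exact intervalIntegral.norm_integral_le_abs_integral_norm

theorem ACloc.continuous {f : ℝ → ℂ} (hf : ACloc f) : Continuous f := by
  refine continuous_iff_continuousAt.2 fun x =>
    (hf (x - 1) (x + 1)).continuousOn.continuousAt ?_
  rw [uIcc_of_le (by linarith)]
  exact Icc_mem_nhds (by linarith) (by linarith)

theorem ACloc.add {f g : ℝ → ℂ} (hf : ACloc f) (hg : ACloc g) : ACloc (fun x => f x + g x) :=
  fun a b => (hf a b).add (hg a b)

theorem ACloc.sub {f g : ℝ → ℂ} (hf : ACloc f) (hg : ACloc g) : ACloc (fun x => f x - g x) :=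
  fun a b => (hf a b).sub (hg a b)

theorem ACloc.mul {f g : ℝ → ℂ} (hf : ACloc f) (hg : ACloc g) : ACloc (fun x => f x * g x) :=
  fun a b => (hf a b).smul (hg a b)

theorem ACloc.neg {f : ℝ → ℂ} (hf : ACloc f) : ACloc (fun x => -f x) :=
  fun a b => (hf a b).neg

theorem ACloc.star {f : ℝ → ℂ} (hf : ACloc f) : ACloc (fun x => star (f x)) := fun a b =>
  absolutelyContinuousOnInterval_comp_of_locallyLipschitz
    (starₗᵢ ℂ).isometry.lipschitz.locallyLipschitz (hf a b)

theorem ACloc.comp_neg {f : ℝ → ℂ} (hf : ACloc f) : ACloc (fun x => f (-x)) := fun a b =>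
  absolutelyContinuousOnInterval_comp_neg (hf (-a) (-b))

theorem ACloc.of_contDiff {f : ℝ → ℂ} (hf : ContDiff ℝ 1 f) : ACloc f := fun _ _ =>
  hf.contDiffOn.absolutelyContinuousOnInterval

theorem ACloc.integral {f : ℝ → ℂ} (hf : LocallyIntegrable f) (c : ℝ) :
    ACloc (fun x => ∫ t in c..x, f t) :=
  absolutelyContinuousOnInterval_intervalIntegral hf c

theorem ACloc.eq_of_ae_hasDerivAt_zero {f : ℝ → ℂ} (hf : ACloc f)
    (h : ∀ᵐ x, HasDerivAt f 0 x) (a b : ℝ) : f a = f b := by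
  obtain ⟨C, hC⟩ := (hf a b).const_of_ae_hasDerivAt_zero (h.mono fun x hx _ => hx)
  rw [hC a left_mem_uIcc, hC b right_mem_uIcc]

theorem ACloc.integral_eq_sub {f g : ℝ → ℂ} (hf : ACloc f) (hg : LocallyIntegrable g)
    (h : ∀ᵐ x, HasDerivAt f (g x) x) (a b : ℝ) : ∫ t in a..b, g t = f b - f a := by
  have hac : ACloc (fun x => f x - ∫ t in a..x, g t) := hf.sub (ACloc.integral hg a)
  have hderiv : ∀ᵐ x, HasDerivAt (fun x => f x - ∫ t in a..x, g t) 0 x := by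
    filter_upwards [h, LocallyIntegrable.ae_hasDerivAt_integral hg] with x hx hx'
    simpa only [sub_self] using hx.fun_sub (hx' a)
  have heq := hac.eq_of_ae_hasDerivAt_zero hderiv a b
  rw [intervalIntegral.integral_same, sub_zero] at heq
  rw [heq, sub_sub_cancel]

theorem ACloc.integral_eq_zero_of_hasCompactSupport {f g : ℝ → ℂ} (hf : ACloc f)
    (hg : Integrable g) (h : ∀ᵐ x, HasDerivAt f (g x) x) (hc : HasCompactSupport f) :
    ∫ t, g t = 0 := by
  obtain ⟨R, -, hz⟩ := hc.exists_pos_le_norm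
  refine tendsto_nhds_unique
    (intervalIntegral_tendsto_integral hg tendsto_neg_atTop_atBot tendsto_id)
    (tendsto_const_nhds.congr' ?_)
  filter_upwards [eventually_ge_atTop R] with x hx
  have hx' : R ≤ ‖x‖ := hx.trans (Real.le_norm_self x)
  rw [id, hf.integral_eq_sub hg.locallyIntegrable h, hz x hx', hz (-x) (by rwa [norm_neg]),
    sub_zero]

end AbsoluteContinuity

/-! ### Linear differential equations with locally integrable coefficients -/

section LinearODE

variable {E : Type*} [NormedAddCommGroup E]

theorem locallyIntegrable_norm {f : ℝ → E} (hf : LocallyIntegrable f) :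
    LocallyIntegrable fun x => ‖f x‖ :=
  locallyIntegrableOn_univ.1 (hf.locallyIntegrableOn univ).norm

theorem integral_mul_cosh_primitive {m : ℝ → ℝ} (hm : LocallyIntegrable m) (c x : ℝ) :
    ∫ t in (0 : ℝ)..x, c * m t * Real.cosh (c * ∫ s in (0 : ℝ)..t, m s)
      = Real.sinh (c * ∫ s in (0 : ℝ)..x, m s) := by
  have hac : AbsolutelyContinuousOnInterval
      (fun x => Real.sinh (c * ∫ s in (0 : ℝ)..x, m s)) 0 x :=
    absolutelyContinuousOnInterval_comp_of_locallyLipschitz Real.contDiff_sinh.locallyLipschitz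
      ((absolutelyContinuousOnInterval_intervalIntegral hm 0 0 x).const_mul c)
  have hftc := hac.integral_deriv_eq_sub
  rw [intervalIntegral.integral_same, mul_zero, Real.sinh_zero, sub_zero] at hftc
  rw [← hftc]
  refine intervalIntegral.integral_congr_ae ?_
  filter_upwards [LocallyIntegrable.ae_hasDerivAt_integral hm] with t ht _
  rw [((ht 0).const_mul c).sinh.deriv, mul_comm]

variable [NormedSpace ℝ E] {L : ℝ → E →L[ℝ] E}

/-- The weight `cosh (2 ∫₀ˣ ‖L‖)`, in which the Picard map of `Y' = L Y` is a contraction of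
ratio `1 / 2` on the whole line. -/
noncomputable def picardWeight (L : ℝ → E →L[ℝ] E) (x : ℝ) : ℝ :=
  Real.cosh (2 * ∫ s in (0 : ℝ)..x, ‖L s‖)

theorem one_le_picardWeight (L : ℝ → E →L[ℝ] E) (x : ℝ) : 1 ≤ picardWeight L x :=
  Real.one_le_cosh _

theorem picardWeight_pos (L : ℝ → E →L[ℝ] E) (x : ℝ) : 0 < picardWeight L x :=
  Real.cosh_pos _

theorem continuous_picardWeight (hL : LocallyIntegrable L) : Continuous (picardWeight L) :=
  Real.continuous_cosh.comp <| continuous_const.mul <| intervalIntegral.continuous_primitive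
    (intervalIntegrable_of_locallyIntegrable (locallyIntegrable_norm hL)) 0

theorem locallyIntegrable_clm_apply (hL : LocallyIntegrable L) {Y : ℝ → E} (hY : Continuous Y) :
    LocallyIntegrable fun t => L t (Y t) := by
  refine locallyIntegrable_iff.2 fun k hk => ?_
  obtain ⟨C, hC⟩ := (hk.image hY).isBounded.exists_norm_le
  exact (ContinuousLinearMap.id ℝ (E →L[ℝ] E)).integrable_of_bilin_of_bdd_right C
    (hL.integrableOn_isCompact hk) hY.aestronglyMeasurable <|
    ae_restrict_of_forall_mem hk.measurableSet fun x hx => hC _ (mem_image_of_mem Y hx)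

theorem abs_integral_norm_mul_picardWeight_le (hL : LocallyIntegrable L) (x : ℝ) :
    |∫ t in (0 : ℝ)..x, ‖L t‖ * picardWeight L t| ≤ picardWeight L x / 2 := by
  have hsinh := integral_mul_cosh_primitive (locallyIntegrable_norm hL) 2 x
  simp only [mul_assoc, intervalIntegral.integral_const_mul] at hsinh
  have hle : |Real.sinh (2 * ∫ s in (0 : ℝ)..x, ‖L s‖)| ≤ picardWeight L x := by
    rw [Real.abs_sinh, picardWeight, ← Real.cosh_abs]
    exact (Real.sinh_lt_cosh _).le
  rw [← hsinh, abs_mul, abs_two] at hle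
  rw [le_div_iff₀' two_pos]
  exact hle

theorem norm_integral_clm_apply_le (hL : LocallyIntegrable L) {Z : ℝ → E} {C : ℝ}
    (hZ : ∀ t, ‖Z t‖ ≤ C * picardWeight L t) (x : ℝ) :
    ‖∫ t in (0 : ℝ)..x, L t (Z t)‖ ≤ C * (picardWeight L x / 2) := by
  have hC : 0 ≤ C := nonneg_of_mul_nonneg_left ((norm_nonneg _).trans (hZ 0)) (picardWeight_pos L 0)
  have hint : IntervalIntegrable (fun t => ‖L t‖ * picardWeight L t) volume 0 x :=
    (intervalIntegrable_of_locallyIntegrable (locallyIntegrable_norm hL) 0 x).mul_continuousOn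
      (continuous_picardWeight hL).continuousOn
  calc ‖∫ t in (0 : ℝ)..x, L t (Z t)‖
      ≤ |∫ t in (0 : ℝ)..x, C * (‖L t‖ * picardWeight L t)| := by
        refine intervalIntegral.norm_integral_le_abs_of_norm_le (ae_of_all _ fun t => ?_)
          (hint.const_mul C)
        rw [mul_left_comm]
        exact (L t).le_opNorm_of_le (hZ t)
    _ = C * |∫ t in (0 : ℝ)..x, ‖L t‖ * picardWeight L t| := by
        rw [intervalIntegral.integral_const_mul, abs_mul, abs_of_nonneg hC]
    _ ≤ C * (picardWeight L x / 2) := by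
        gcongr
        exact abs_integral_norm_mul_picardWeight_le hL x

theorem norm_weight_smul_le (L : ℝ → E →L[ℝ] E) (u : ℝ →ᵇ E) (t : ℝ) :
    ‖picardWeight L t • u t‖ ≤ ‖u‖ * picardWeight L t := by
  rw [norm_smul, Real.norm_of_nonneg (picardWeight_pos L t).le, mul_comm]
  have hW := picardWeight_pos L t
  gcongr
  exact u.norm_coe_le_norm t

theorem locallyIntegrable_clm_apply_weight_smul (hL : LocallyIntegrable L) (u : ℝ →ᵇ E) :
    LocallyIntegrable fun t => L t (picardWeight L t • u t) :=
  locallyIntegrable_clm_apply hL ((continuous_picardWeight hL).smul u.continuous)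

/-- The Picard map `Y ↦ Y₀ + ∫₀ˣ L Y` of the equation `Y' = L Y`, conjugated with multiplication
by `picardWeight L`. -/
noncomputable def weightedPicard (hL : LocallyIntegrable L) (Y₀ : E) (u : ℝ →ᵇ E) : ℝ →ᵇ E :=
  BoundedContinuousFunction.ofNormedAddCommGroup
    (fun x => (picardWeight L x)⁻¹ •
      (Y₀ + ∫ t in (0 : ℝ)..x, L t (picardWeight L t • u t)))
    (((continuous_picardWeight hL).inv₀ fun x => (picardWeight_pos L x).ne').smul <|
      continuous_const.add <| intervalIntegral.continuous_primitive
        (intervalIntegrable_of_locallyIntegrable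
          (locallyIntegrable_clm_apply_weight_smul hL u)) 0)
    (‖Y₀‖ + ‖u‖ / 2) fun x => by
      have hint := norm_integral_clm_apply_le hL (norm_weight_smul_le L u) x
      have hadd := norm_add_le Y₀ (∫ t in (0 : ℝ)..x, L t (picardWeight L t • u t))
      rw [norm_smul, norm_inv, Real.norm_of_nonneg (picardWeight_pos L x).le,
        inv_mul_le_iff₀ (picardWeight_pos L x)]
      nlinarith [one_le_picardWeight L x, norm_nonneg Y₀]

theorem weightedPicard_apply (hL : LocallyIntegrable L) (Y₀ : E) (u : ℝ →ᵇ E) (x : ℝ) :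
    weightedPicard hL Y₀ u x = (picardWeight L x)⁻¹ •
      (Y₀ + ∫ t in (0 : ℝ)..x, L t (picardWeight L t • u t)) :=
  rfl

theorem contractingWith_weightedPicard (hL : LocallyIntegrable L) (Y₀ : E) :
    ContractingWith (1 / 2) (weightedPicard hL Y₀) := by
  refine ⟨by norm_num, LipschitzWith.of_dist_le_mul fun u v => ?_⟩
  rw [BoundedContinuousFunction.dist_le (by positivity)]
  intro x
  have hint (w : ℝ →ᵇ E) : IntervalIntegrable (fun t => L t (picardWeight L t • w t)) volume 0 x :=
    intervalIntegrable_of_locallyIntegrable (locallyIntegrable_clm_apply_weight_smul hL w) 0 x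
  have hdiff : weightedPicard hL Y₀ u x - weightedPicard hL Y₀ v x =
      (picardWeight L x)⁻¹ • ∫ t in (0 : ℝ)..x, L t (picardWeight L t • (u - v) t) := by
    rw [weightedPicard_apply, weightedPicard_apply, ← smul_sub, add_sub_add_left_eq_sub,
      ← intervalIntegral.integral_sub (hint u) (hint v)]
    simp only [← map_sub, ← smul_sub, BoundedContinuousFunction.coe_sub, Pi.sub_apply]
  rw [dist_eq_norm, dist_eq_norm, hdiff, norm_smul, norm_inv,
    Real.norm_of_nonneg (picardWeight_pos L x).le, inv_mul_le_iff₀ (picardWeight_pos L x)]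
  refine (norm_integral_clm_apply_le hL (norm_weight_smul_le L (u - v)) x).trans_eq ?_
  push_cast
  ring

theorem exists_integral_solution [CompleteSpace E] (hL : LocallyIntegrable L) (Y₀ : E) :
    ∃ Y : ℝ → E, Continuous Y ∧ ∀ x, Y x = Y₀ + ∫ t in (0 : ℝ)..x, L t (Y t) := by
  have hcontr := contractingWith_weightedPicard hL Y₀
  set u := hcontr.fixedPoint
  have hfix : weightedPicard hL Y₀ u = u := hcontr.fixedPoint_isFixedPt
  refine ⟨fun x => picardWeight L x • u x, (continuous_picardWeight hL).smul u.continuous,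
    fun x => ?_⟩
  rw [← smul_inv_smul₀ (picardWeight_pos L x).ne' (Y₀ + _), ← weightedPicard_apply hL, hfix]

end LinearODE

/-! ### The Sturm-Liouville equation -/

section SturmLiouville

variable {q : ℝ → ℝ} {z : ℂ} {y w : ℝ → ℂ}

theorem IsRegular.hasDerivAt (hy : IsRegular y) (x : ℝ) : HasDerivAt y (deriv y x) x :=
  (hy.differentiable x).hasDerivAt

theorem IsRegular.ae_hasDerivAt_deriv (hy : IsRegular y) :
    ∀ᵐ x : ℝ, HasDerivAt (deriv y) (deriv (deriv y) x) x :=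
  hy.ae_differentiableAt.mono fun _ hx => hx.hasDerivAt

theorem IsRegular.continuous (hy : IsRegular y) : Continuous y := hy.differentiable.continuous

theorem ACloc.of_hasDerivAt (h : ∀ x, HasDerivAt y (w x) x) (hw : Continuous w) : ACloc y := by
  refine ACloc.of_contDiff (contDiff_one_iff_deriv.2 ⟨fun x => (h x).differentiableAt, ?_⟩)
  rwa [deriv_eq h]

theorem IsRegular.of_hasDerivAt (h : ∀ x, HasDerivAt y (w x) x) (hw : ACloc w) : IsRegular y where
  differentiable x := (h x).differentiableAt
  acloc := .of_hasDerivAt h hw.continuous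
  acloc_deriv := by rwa [deriv_eq h]

theorem IsRegular.of_contDiff (hy : ContDiff ℝ 2 y) : IsRegular y :=
  .of_hasDerivAt (fun x => (hy.differentiable two_ne_zero x).hasDerivAt)
    (.of_contDiff (contDiff_succ_iff_deriv (n := 1).1 hy).2.2)

theorem IsRegular.mul (hy : IsRegular y) (hw : IsRegular w) : IsRegular fun x => y x * w x :=
  .of_hasDerivAt (fun x => (hy.hasDerivAt x).mul (hw.hasDerivAt x))
    ((hy.acloc_deriv.mul hw.acloc).add (hy.acloc.mul hw.acloc_deriv))

theorem deriv_star_comp (y : ℝ → ℂ) : deriv (fun x => star (y x)) = fun x => star (deriv y x) :=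
  funext fun _ => deriv.star

theorem IsRegular.star (hy : IsRegular y) : IsRegular fun x => star (y x) :=
  .of_hasDerivAt (fun x => (hy.hasDerivAt x).star) hy.acloc_deriv.star

theorem tau_star (q : ℝ → ℝ) (y : ℝ → ℂ) :
    tau q (fun x => star (y x)) = fun x => star (tau q y x) := by
  funext x
  rw [tau, tau, deriv_star_comp, deriv_star_comp, star_sub, star_neg, star_mul',
    Complex.star_def, Complex.conj_ofReal]

theorem IsSolution.star (hy : IsSolution q z y) :
    IsSolution q (star z) fun x => star (y x) := by
  refine ⟨hy.1.star, ?_⟩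
  filter_upwards [hy.2] with x hx
  rw [tau_star, ← star_mul', ← star_sub, hx, star_zero]

theorem IsSolution.ae_hasDerivAt_deriv (hy : IsSolution q z y) :
    ∀ᵐ x, HasDerivAt (deriv y) (-(q x + z) * y x) x := by
  filter_upwards [hy.2, hy.1.ae_hasDerivAt_deriv] with x hx hd
  refine hd.congr_deriv ?_
  simp only [tau] at hx
  linear_combination -hx

theorem IsSolution.tau_mul (hy : IsSolution q z y) {g : ℝ → ℂ} (hg : IsRegular g) :
    ∀ᵐ x, tau q (fun x => y x * g x) x =
      z * (y x * g x) - (2 * (deriv y x * deriv g x) + y x * deriv (deriv g) x) := by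
  have hderiv : deriv (fun x => y x * g x) = fun x => deriv y x * g x + y x * deriv g x :=
    deriv_eq fun x => (hy.1.hasDerivAt x).mul (hg.hasDerivAt x)
  filter_upwards [hy.ae_hasDerivAt_deriv, hg.ae_hasDerivAt_deriv] with x hy' hg'
  have hderiv' := (hy'.fun_mul (hg.hasDerivAt x)).fun_add ((hy.1.hasDerivAt x).fun_mul hg')
  simp only [tau, hderiv, hderiv'.deriv]
  ring

theorem IsSolution.memLp (htop : LimitCircleAtTop q) (hbot : LimitCircleAtBot q)
    (hy : IsSolution q z y) : MemLp y 2 := by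
  obtain ⟨a, ha⟩ := htop z y hy
  obtain ⟨b, hb⟩ := hbot z y hy
  have hc : Continuous y := hy.1.continuous
  rw [memLp_two_iff_integrable_sq_norm hc.aestronglyMeasurable] at ha hb ⊢
  have hmid : IntegrableOn (fun x => ‖y x‖ ^ 2) (Icc b a) :=
    (by fun_prop : Continuous fun x => ‖y x‖ ^ 2).continuousOn.integrableOn_compact isCompact_Icc
  have hcover : Iio b ∪ Icc b a ∪ Ioi a = univ := by
    ext x
    simp only [mem_union, mem_Iio, mem_Icc, mem_Ioi, mem_univ, iff_true]
    grind
  rw [← integrableOn_univ, ← hcover]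
  exact (IntegrableOn.union hb hmid).union ha

/-- The Wronskian `y w' - y' w`, which detects linear independence of two solutions; the sign is
chosen so that `y 0 = 1`, `y' 0 = 0`, `w 0 = 0`, `w' 0 = 1` gives the value `1`. -/
noncomputable def wronskian (y w : ℝ → ℂ) (x : ℝ) : ℂ := y x * deriv w x - deriv y x * w x

theorem IsSolution.wronskian_eq (hy : IsSolution q z y) (hw : IsSolution q z w) (a b : ℝ) :
    wronskian y w a = wronskian y w b := by
  refine ((hy.1.acloc.mul hw.1.acloc_deriv).sub
    (hy.1.acloc_deriv.mul hw.1.acloc)).eq_of_ae_hasDerivAt_zero ?_ a b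
  filter_upwards [hy.ae_hasDerivAt_deriv, hw.ae_hasDerivAt_deriv] with x hy' hw'
  refine (((hy.1.hasDerivAt x).mul hw').sub (hy'.mul (hw.1.hasDerivAt x))).congr_deriv ?_
  ring

theorem wronskian_star (y w : ℝ → ℂ) (x : ℝ) :
    wronskian (fun t => star (y t)) (fun t => star (w t)) x = star (wronskian y w x) := by
  simp only [wronskian, deriv_star_comp, star_sub, star_mul']

theorem linearIndependent_toLp_of_wronskian_ne_zero (hy : Differentiable ℝ y)
    (hw : Differentiable ℝ w) (hym : MemLp y 2) (hwm : MemLp w 2) {x : ℝ}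
    (hW : wronskian y w x ≠ 0) : LinearIndependent ℂ ![hym.toLp y, hwm.toLp w] := by
  rw [LinearIndependent.pair_iff]
  intro c d hcd
  have hzero : (fun x => c * y x + d * w x) = fun _ => 0 := by
    refine (Continuous.ae_eq_iff_eq volume ?_ continuous_const).1 ?_
    · have := hy.continuous
      have := hw.continuous
      fun_prop
    · rw [← MemLp.toLp_const_smul, ← MemLp.toLp_const_smul, ← MemLp.toLp_add] at hcd
      exact (MemLp.coeFn_toLp _).symm.trans (hcd ▸ Lp.coeFn_zero ℂ 2 volume)
  have hvalue : c * y x + d * w x = 0 := congrFun hzero x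
  have hslope : c * deriv y x + d * deriv w x = 0 := by
    have h := ((hy x).hasDerivAt.const_mul c).fun_add ((hw x).hasDerivAt.const_mul d)
    exact h.unique (hzero ▸ hasDerivAt_const x 0)
  simp only [wronskian] at hW
  constructor
  · refine (mul_eq_zero.1 ?_).resolve_right hW
    linear_combination deriv w x * hvalue - w x * hslope
  · refine (mul_eq_zero.1 ?_).resolve_right hW
    linear_combination y x * hslope - deriv y x * hvalue

/-- The coefficient of the first order system `Y' = L Y` for `Y = (y, y')` that is equivalent to
`y'' = -p y`. -/
noncomputable def companionField (p : ℝ → ℂ) (t : ℝ) : ℂ × ℂ →L[ℝ] ℂ × ℂ :=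
  .inl ℝ ℂ ℂ ∘L .snd ℝ ℂ ℂ - p t • (.inr ℝ ℂ ℂ ∘L .fst ℝ ℂ ℂ)

theorem companionField_apply (p : ℝ → ℂ) (t : ℝ) (Y : ℂ × ℂ) :
    companionField p t Y = (Y.2, -(p t * Y.1)) := by
  simp [companionField]

theorem locallyIntegrable_companionField {p : ℝ → ℂ} (hp : LocallyIntegrable p) :
    LocallyIntegrable (companionField p) := by
  refine (locallyIntegrable_const _).sub (locallyIntegrable_iff.2 fun k hk => ?_)
  exact (hp.integrableOn_isCompact hk).smul_const _

theorem exists_hasDerivAt_of_locallyIntegrable {p : ℝ → ℂ} (hp : LocallyIntegrable p) (a b : ℂ) :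
    ∃ y w : ℝ → ℂ, (∀ x, HasDerivAt y (w x) x) ∧ ACloc w ∧
      (∀ᵐ x, HasDerivAt w (-(p x * y x)) x) ∧ y 0 = a ∧ w 0 = b := by
  have hL := locallyIntegrable_companionField hp
  obtain ⟨Y, hYc, hY⟩ := exists_integral_solution hL (a, b)
  have hLY := locallyIntegrable_clm_apply hL hYc
  simp only [companionField_apply] at hY hLY
  have hint := intervalIntegrable_of_locallyIntegrable hLY
  have hfst (x : ℝ) : (Y x).1 = a + ∫ t in (0 : ℝ)..x, (Y t).2 := by
    rw [hY x]
    exact congrArg (a + ·)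
      ((ContinuousLinearMap.fst ℝ ℂ ℂ).intervalIntegral_comp_comm (hint 0 x)).symm
  have hsnd (x : ℝ) : (Y x).2 = b + ∫ t in (0 : ℝ)..x, -(p t * (Y t).1) := by
    rw [hY x]
    exact congrArg (b + ·)
      ((ContinuousLinearMap.snd ℝ ℂ ℂ).intervalIntegral_comp_comm (hint 0 x)).symm
  have hpY : LocallyIntegrable fun t => -(p t * (Y t).1) :=
    locallyIntegrable_iff.2 fun k hk => (hLY.integrableOn_isCompact hk).snd
  refine ⟨fun x => (Y x).1, fun x => (Y x).2, fun x => ?_, ?_, ?_, by simp [hfst], by simp [hsnd]⟩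
  · rw [funext hfst]
    exact ((continuous_snd.comp hYc).integral_hasStrictDerivAt 0 x).hasDerivAt.const_add a
  · rw [funext hsnd]
    exact (ACloc.of_contDiff contDiff_const).add (ACloc.integral hpY 0)
  · filter_upwards [LocallyIntegrable.ae_hasDerivAt_integral hpY] with x hx
    rw [funext hsnd]
    exact (hx 0).const_add b

theorem exists_isSolution (hq : LocallyIntegrable q) (z a b : ℂ) :
    ∃ y, IsSolution q z y ∧ y 0 = a ∧ deriv y 0 = b := by
  have hp : LocallyIntegrable fun t => (q t : ℂ) + z :=
    (locallyIntegrable_iff.2 fun k hk => (hq.integrableOn_isCompact hk).ofReal).add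
      (locallyIntegrable_const z)
  obtain ⟨y, w, hyw, hw, hw', hy0, hw0⟩ := exists_hasDerivAt_of_locallyIntegrable hp a b
  have hderiv : deriv y = w := deriv_eq hyw
  refine ⟨y, ⟨.of_hasDerivAt hyw hw, ?_⟩, hy0, by rw [hderiv, hw0]⟩
  filter_upwards [hw'] with x hx
  rw [tau, hderiv, hx.deriv]
  ring

theorem exists_isSolution_wronskian_eq_one (hq : LocallyIntegrable q) (z : ℂ) :
    ∃ y w, IsSolution q z y ∧ IsSolution q z w ∧ ∀ x, wronskian y w x = 1 := by
  obtain ⟨y, hy, hy0, hy1⟩ := exists_isSolution hq z 1 0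
  obtain ⟨w, hw, hw0, hw1⟩ := exists_isSolution hq z 0 1
  refine ⟨y, w, hy, hw, fun x => ?_⟩
  rw [hy.wronskian_eq hw x 0, wronskian, hy0, hy1, hw0, hw1]
  ring

end SturmLiouville

/-! ### The minimal operator and its deficiency spaces -/

section MinimalOperator

variable {q : ℝ → ℝ} {z : ℂ} {y w : ℝ → ℂ}

theorem mem_graph_maximalOperator_iff {f g : L2R} :
    (f, g) ∈ (maximalOperator q).graph ↔
      ∃ y : ℝ → ℂ, IsRegular y ∧ f =ᵐ[volume] y ∧ g =ᵐ[volume] tau q y := by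
  rw [maximalOperator_graph]
  rfl

theorem mem_graph_preminimalOperator_iff {f g : L2R} :
    (f, g) ∈ (preminimalOperator q).graph ↔
      ∃ y : ℝ → ℂ, IsRegular y ∧ HasCompactSupport y ∧ f =ᵐ[volume] y ∧ g =ᵐ[volume] tau q y := by
  rw [preminimalOperator, mem_graph_domRestrict_iff, mem_graph_maximalOperator_iff]
  constructor
  · rintro ⟨⟨w, hw, hwc, hfw⟩, y, hy, hfy, hgy⟩
    have hwy : w = y := (Continuous.ae_eq_iff_eq volume hw.continuous hy.continuous).1
      (hfw.symm.trans hfy)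
    exact ⟨y, hy, hwy ▸ hwc, hfy, hgy⟩
  · rintro ⟨y, hy, hyc, hfy, hgy⟩
    exact ⟨⟨y, hy, hyc, hfy⟩, y, hy, hfy, hgy⟩

theorem inner_eq_inner_of_mem_graph {a b f g : L2R} (hab : (a, b) ∈ (preminimalOperator q).graph)
    (hfg : (f, g) ∈ (maximalOperator q).graph) : inner ℂ b f = inner ℂ a g := by
  obtain ⟨v, hv, hvc, hav, hbv⟩ := mem_graph_preminimalOperator_iff.1 hab
  obtain ⟨y, hy, hfy, hgy⟩ := mem_graph_maximalOperator_iff.1 hfg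
  have hac : ACloc fun x => star (v x) * deriv y x - star (deriv v x) * y x :=
    (hv.acloc.star.mul hy.acloc_deriv).sub (hv.acloc_deriv.star.mul hy.acloc)
  have hsupp : HasCompactSupport fun x => star (v x) * deriv y x - star (deriv v x) * y x :=
    ((hvc.comp_left (g := star) (star_zero _)).mul_right (f' := deriv y)).sub
      ((hvc.deriv.comp_left (g := star) (star_zero _)).mul_right (f' := y))
  rw [← sub_eq_zero, L2.inner_def, L2.inner_def,
    ← integral_sub (L2.integrable_inner b f) (L2.integrable_inner a g)]
  refine hac.integral_eq_zero_of_hasCompactSupport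
    ((L2.integrable_inner b f).sub (L2.integrable_inner a g)) ?_ hsupp
  filter_upwards [hav, hbv, hfy, hgy, hv.ae_hasDerivAt_deriv, hy.ae_hasDerivAt_deriv]
    with x ha hb hf hg hv' hy'
  refine (((hv.hasDerivAt x).star.mul hy').sub (hv'.star.mul (hy.hasDerivAt x))).congr_deriv ?_
  simp only [RCLike.inner_apply, ha, hb, hf, hg, tau, map_sub, map_neg, map_mul,
    Complex.conj_ofReal, Complex.star_def]
  ring

theorem toLp_mul_mem_domain_preminimalOperator (hy : IsSolution q z y) {g : ℝ → ℂ}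
    (hg : ContDiff ℝ 2 g) (hgc : HasCompactSupport g) (hm : MemLp (fun x => y x * g x) 2 volume) :
    hm.toLp _ ∈ (preminimalOperator q).domain := by
  have hgreg := IsRegular.of_contDiff hg
  let τ := fun x => z * (y x * g x) - (2 * (deriv y x * deriv g x) + y x * deriv (deriv g) x)
  have hτc : Continuous τ := by
    have := hy.1.continuous
    have := hy.1.acloc_deriv.continuous
    have := hgreg.continuous
    have := hgreg.acloc_deriv.continuous
    have : Continuous (deriv (deriv g)) :=
      (contDiff_succ_iff_deriv (n := 1).1 hg).2.2.continuous_deriv le_rfl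
    fun_prop
  have hτs : HasCompactSupport τ :=
    ((hgc.mul_left (f := y)).mul_left (f := fun _ => z)).sub
      (((hgc.deriv.mul_left (f := deriv y)).mul_left (f := fun _ => (2 : ℂ))).add
        (hgc.deriv.deriv.mul_left (f := y)))
  have hτm : MemLp τ 2 := hτc.memLp_of_hasCompactSupport hτs
  refine LinearPMap.mem_domain_of_mem_graph (y := hτm.toLp τ)
    (mem_graph_preminimalOperator_iff.2 ⟨_, hy.1.mul hgreg, hgc.mul_left (f := y),
      hm.coeFn_toLp, hτm.coeFn_toLp.trans ?_⟩)
  filter_upwards [hy.tau_mul hgreg] with x hx using hx.symm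

theorem ae_star_mul_eq_zero_of_mem_orthogonal (hy : IsSolution q z y) {u : L2R}
    (hu : u ∈ (preminimalOperator q).domainᗮ) : ∀ᵐ x, star (y x) * u x = 0 := by
  have hyc := hy.1.continuous
  have hloc : LocallyIntegrable fun x => star (y x) * u x := locallyIntegrable_iff.2 fun k hk =>
    (((Lp.memLp u).locallyIntegrable one_le_two).integrableOn_isCompact hk).continuousOn_mul
      (continuous_star.comp hyc).continuousOn hk
  refine ae_eq_zero_of_integral_contDiff_smul_eq_zero hloc fun g hg hgc => ?_
  have hgC : ContDiff ℝ 2 fun x => (g x : ℂ) :=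
    Complex.ofRealCLM.contDiff.comp (contDiff_infty.1 hg 2)
  have hgCc : HasCompactSupport fun x => (g x : ℂ) :=
    hgc.comp_left (g := ((↑) : ℝ → ℂ)) Complex.ofReal_zero
  have hm : MemLp (fun x => y x * (g x : ℂ)) 2 :=
    (hyc.mul hgC.continuous).memLp_of_hasCompactSupport (hgCc.mul_left (f := y))
  have horth := (Submodule.mem_orthogonal _ _).1 hu _
    (toLp_mul_mem_domain_preminimalOperator hy hgC hgCc hm)
  rw [← horth, L2.inner_def]
  refine integral_congr_ae ?_
  filter_upwards [hm.coeFn_toLp] with x hx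
  rw [hx, RCLike.inner_apply, map_mul, Complex.conj_ofReal, Complex.real_smul, Complex.star_def]
  ring

theorem dense_domain_preminimalOperator (hq : LocallyIntegrable q) :
    Dense ((preminimalOperator q).domain : Set L2R) := by
  rw [Submodule.dense_iff_topologicalClosure_eq_top, Submodule.topologicalClosure_eq_top_iff,
    Submodule.eq_bot_iff]
  intro u hu
  obtain ⟨y, w, hy, hw, hW⟩ := exists_isSolution_wronskian_eq_one hq 0
  refine (Lp.eq_zero_iff_ae_eq_zero).2 ?_
  filter_upwards [ae_star_mul_eq_zero_of_mem_orthogonal hy hu,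
    ae_star_mul_eq_zero_of_mem_orthogonal hw hu] with x hyu hwu
  have hWx := hW x
  by_contra hne
  have hyx : y x = 0 := star_eq_zero.1 ((mul_eq_zero.1 hyu).resolve_right hne)
  have hwx : w x = 0 := star_eq_zero.1 ((mul_eq_zero.1 hwu).resolve_right hne)
  simp [wronskian, hyx, hwx] at hWx

theorem maximalOperator_le_adjoint_preminimalOperator (hq : LocallyIntegrable q) :
    maximalOperator q ≤ (preminimalOperator q)† :=
  LinearPMap.le_of_le_graph fun _ hfg =>
    (mem_graph_adjoint_iff (dense_domain_preminimalOperator hq)).2 fun _ _ hab =>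
      inner_eq_inner_of_mem_graph hab hfg

theorem preminimalOperator_le_adjoint (hq : LocallyIntegrable q) :
    preminimalOperator q ≤ (preminimalOperator q)† :=
  LinearPMap.domRestrict_le.trans (maximalOperator_le_adjoint_preminimalOperator hq)

theorem isClosable_preminimalOperator (hq : LocallyIntegrable q) :
    (preminimalOperator q).IsClosable :=
  (LinearPMap.adjoint_isClosed (dense_domain_preminimalOperator hq)).isClosable.leIsClosable
    (preminimalOperator_le_adjoint hq)

theorem isClosed_minimalOperator (hq : LocallyIntegrable q) : (minimalOperator q).IsClosed :=
  (isClosable_preminimalOperator hq).closure_isClosed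

theorem dense_domain_minimalOperator (hq : LocallyIntegrable q) :
    Dense ((minimalOperator q).domain : Set L2R) :=
  (dense_domain_preminimalOperator hq).mono (preminimalOperator q).le_closure.1

theorem adjoint_minimalOperator (hq : LocallyIntegrable q) :
    (minimalOperator q)† = (preminimalOperator q)† :=
  adjoint_closure (dense_domain_preminimalOperator hq) (isClosable_preminimalOperator hq)

theorem minimalOperator_le_adjoint (hq : LocallyIntegrable q) :
    minimalOperator q ≤ (minimalOperator q)† := by
  rw [adjoint_minimalOperator hq]
  exact closure_le_of_isClosed (LinearPMap.adjoint_isClosed (dense_domain_preminimalOperator hq))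
    (preminimalOperator_le_adjoint hq)

end MinimalOperator

section DeficiencySpaces

variable {q : ℝ → ℝ} {z : ℂ} {y w : ℝ → ℂ}

theorem exists_hasCompactSupport_hasDerivAt {E : Type*} [NormedAddCommGroup E] [NormedSpace ℝ E]
    [CompleteSpace E] {g : ℝ → E} (hg : Continuous g) (hc : HasCompactSupport g)
    (h0 : ∫ x, g x = 0) : ∃ G : ℝ → E, HasCompactSupport G ∧ ∀ x, HasDerivAt G (g x) x := by
  obtain ⟨R, -, hR⟩ := hc.exists_pos_le_norm
  refine ⟨fun x => ∫ t in (-R)..x, g t,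
    HasCompactSupport.intro (isCompact_Icc (a := -R) (b := R)) fun x hx => ?_,
    fun x => (hg.integral_hasStrictDerivAt (-R) x).hasDerivAt⟩
  rcases lt_or_ge x (-R) with hlt | hge
  · refine intervalIntegral.integral_zero_ae (ae_of_all _ fun t ht => hR t ?_)
    rw [uIoc_of_ge hlt.le] at ht
    exact (le_neg.1 ht.2).trans (neg_le_abs t)
  · have hlt : R < x := not_le.1 fun hle => hx ⟨hge, hle⟩
    rw [intervalIntegral.integral_eq_integral_of_support_subset, h0]
    intro t ht
    have habs : |t| < R := not_le.1 fun hle => ht (hR t hle)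
    exact ⟨(abs_lt.1 habs).1, ((abs_lt.1 habs).2.trans hlt).le⟩

/-- Variation of constants: if `F' = y f` and `G' = w f`, then `v = w F - y G` satisfies
`τ_q v = z v - f`. -/
theorem exists_hasCompactSupport_tau_eq (hy : IsSolution q z y) (hw : IsSolution q z w)
    (hW : ∀ x, wronskian y w x = 1) {f : ℝ → ℂ} (hf : Continuous f) (hfc : HasCompactSupport f)
    (hyf : ∫ x, y x * f x = 0) (hwf : ∫ x, w x * f x = 0) :
    ∃ v, IsRegular v ∧ HasCompactSupport v ∧ ∀ᵐ x, tau q v x = z * v x - f x := by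
  have hyfc : Continuous fun x => y x * f x := hy.1.continuous.mul hf
  have hwfc : Continuous fun x => w x * f x := hw.1.continuous.mul hf
  obtain ⟨F, hFc, hF⟩ := exists_hasCompactSupport_hasDerivAt hyfc (hfc.mul_left (f := y)) hyf
  obtain ⟨G, hGc, hG⟩ := exists_hasCompactSupport_hasDerivAt hwfc (hfc.mul_left (f := w)) hwf
  have hv (x : ℝ) : HasDerivAt (fun x => w x * F x - y x * G x)
      (deriv w x * F x - deriv y x * G x) x :=
    (((hw.1.hasDerivAt x).mul (hF x)).sub ((hy.1.hasDerivAt x).mul (hG x))).congr_deriv (by ring)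
  refine ⟨_, .of_hasDerivAt hv ((hw.1.acloc_deriv.mul (.of_hasDerivAt hF hyfc)).sub
    (hy.1.acloc_deriv.mul (.of_hasDerivAt hG hwfc))),
    (hFc.mul_left (f := w)).sub (hGc.mul_left (f := y)), ?_⟩
  filter_upwards [hy.ae_hasDerivAt_deriv, hw.ae_hasDerivAt_deriv] with x hy' hw'
  have hv' := (hw'.fun_mul (hF x)).fun_sub (hy'.fun_mul (hG x))
  have hWx := hW x
  rw [wronskian] at hWx
  rw [tau, deriv_eq hv, hv'.deriv]
  linear_combination -(f x) * hWx

/-- The classes in `L²(ℝ)` of continuous functions with compact support, the right hand sides for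
which the inhomogeneous equation is solved. -/
def compactlySupportedContinuous : Submodule ℂ L2R where
  carrier := {f | ∃ g : ℝ → ℂ, Continuous g ∧ HasCompactSupport g ∧ f =ᵐ[volume] g}
  zero_mem' := ⟨0, continuous_zero, HasCompactSupport.zero, Lp.coeFn_zero _ _ _⟩
  add_mem' := by
    rintro f g ⟨y, hy, hyc, hfy⟩ ⟨w, hw, hwc, hgw⟩
    exact ⟨y + w, hy.add hw, hyc.add hwc, (Lp.coeFn_add _ _).trans (hfy.add hgw)⟩
  smul_mem' := by
    rintro c f ⟨y, hy, hyc, hfy⟩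
    exact ⟨c • y, hy.const_smul c, hyc.smul_left (f := fun _ => c),
      (Lp.coeFn_smul _ _).trans (hfy.const_smul c)⟩

theorem dense_compactlySupportedContinuous : Dense (compactlySupportedContinuous : Set L2R) := by
  refine (Lp.dense_hasCompactSupport_contDiff (E := ℝ) (F := ℂ) (μ := volume) (p := 2)
    (by norm_num)).mono ?_
  rintro f ⟨g, hfg, hgc, hg⟩
  exact ⟨g, hg.continuous, hgc, hfg⟩

theorem mem_span_pair_of_forall_inner_eq_zero {𝕜 E : Type*} [RCLike 𝕜] [NormedAddCommGroup E]
    [InnerProductSpace 𝕜 E] {D : Submodule 𝕜 E} (hD : Dense (D : Set E)) {a b x : E}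
    (h : ∀ f ∈ D, inner 𝕜 a f = 0 → inner 𝕜 b f = 0 → inner 𝕜 x f = 0) :
    x ∈ Submodule.span 𝕜 {a, b} := by
  let L (u : E) : D →ₗ[𝕜] 𝕜 := (innerSL 𝕜 u).toLinearMap ∘ₗ D.subtype
  have hmem : L x ∈ Submodule.span 𝕜 (range ![L a, L b]) := by
    refine mem_span_of_iInf_ker_le_ker fun f hf => ?_
    rw [Submodule.mem_iInf] at hf
    exact h f f.2 (hf 0) (hf 1)
  rw [Matrix.range_cons_cons_empty] at hmem
  obtain ⟨c, d, hcd⟩ := Submodule.mem_span_pair.1 hmem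
  refine Submodule.mem_span_pair.2 ⟨star c, star d, hD.eq_of_inner_left 𝕜 fun f hf => ?_⟩
  have hf := congrArg (fun l => l ⟨f, hf⟩) hcd
  simpa [L, inner_add_left, inner_smul_left] using hf

theorem toLp_mem_deficiencySpace (hq : LocallyIntegrable q) (hy : IsSolution q z y)
    (hym : MemLp y 2 volume) : hym.toLp y ∈ deficiencySpace (preminimalOperator q) z := by
  refine mem_deficiencySpace_iff.2 (LinearPMap.le_graph_of_le
    (maximalOperator_le_adjoint_preminimalOperator hq)
    (mem_graph_maximalOperator_iff.2 ⟨y, hy.1, hym.coeFn_toLp, ?_⟩))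
  filter_upwards [Lp.coeFn_smul z (hym.toLp y), hym.coeFn_toLp, hy.2] with x hzx hx hτ
  rw [hzx, Pi.smul_apply, hx, smul_eq_mul, sub_eq_zero.1 hτ]

theorem inner_toLp_eq_integral (hym : MemLp y 2 volume) {f : L2R} {g : ℝ → ℂ}
    (hfg : f =ᵐ[volume] g) :
    inner ℂ (hym.toLp y) f = ∫ x, star (y x) * g x := by
  rw [L2.inner_def]
  refine integral_congr_ae ?_
  filter_upwards [hym.coeFn_toLp, hfg] with x hyx hfx
  rw [hyx, hfx, RCLike.inner_apply, mul_comm, Complex.star_def]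

theorem deficiencySpace_preminimalOperator_le_span (hq : LocallyIntegrable q)
    (hy : IsSolution q z y) (hw : IsSolution q z w) (hW : ∀ x, wronskian y w x = 1)
    (hym : MemLp y 2 volume) (hwm : MemLp w 2 volume) :
    deficiencySpace (preminimalOperator q) z ≤ Submodule.span ℂ {hym.toLp y, hwm.toLp w} := by
  intro u hu
  refine mem_span_pair_of_forall_inner_eq_zero dense_compactlySupportedContinuous ?_
  rintro f ⟨g, hg, hgc, hfg⟩ hyf hwf
  rw [inner_toLp_eq_integral _ hfg] at hyf hwf
  have hWstar (x : ℝ) : wronskian (fun t => star (y t)) (fun t => star (w t)) x = 1 := by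
    rw [wronskian_star, hW, star_one]
  obtain ⟨v, hv, hvc, hτv⟩ :=
    exists_hasCompactSupport_tau_eq hy.star hw.star hWstar hg hgc hyf hwf
  have hvm : MemLp v 2 := hv.continuous.memLp_of_hasCompactSupport hvc
  have hgraph : (hvm.toLp v, star z • hvm.toLp v - f) ∈ (preminimalOperator q).graph := by
    refine mem_graph_preminimalOperator_iff.2 ⟨v, hv, hvc, hvm.coeFn_toLp, ?_⟩
    filter_upwards [Lp.coeFn_sub (star z • hvm.toLp v) f, Lp.coeFn_smul (star z) (hvm.toLp v),
      hvm.coeFn_toLp, hfg, hτv] with x hsub hsmul hvx hfx hτx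
    rw [hsub, Pi.sub_apply, hsmul, Pi.smul_apply, hvx, hfx, hτx, smul_eq_mul]
  have hinner := (mem_graph_adjoint_iff (dense_domain_preminimalOperator hq)).1
    (mem_deficiencySpace_iff.1 hu) _ _ hgraph
  rw [inner_sub_left, inner_smul_left, inner_smul_right, Complex.star_def, Complex.conj_conj,
    sub_eq_self] at hinner
  exact inner_eq_zero_symm.1 hinner

theorem rank_deficiencySpace_minimalOperator (hq : LocallyIntegrable q)
    (htop : LimitCircleAtTop q) (hbot : LimitCircleAtBot q) (z : ℂ) :
    Module.rank ℂ (deficiencySpace (minimalOperator q) z) = 2 := by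
  obtain ⟨y, w, hy, hw, hW⟩ := exists_isSolution_wronskian_eq_one hq z
  have hym := hy.memLp htop hbot
  have hwm := hw.memLp htop hbot
  have hspan : deficiencySpace (minimalOperator q) z =
      Submodule.span ℂ (range ![hym.toLp y, hwm.toLp w]) := by
    rw [deficiencySpace, adjoint_minimalOperator hq, ← deficiencySpace,
      Matrix.range_cons_cons_empty]
    refine (deficiencySpace_preminimalOperator_le_span hq hy hw hW hym hwm).antisymm ?_
    exact Submodule.span_le.2 (pair_subset (toLp_mem_deficiencySpace hq hy hym)
      (toLp_mem_deficiencySpace hq hw hwm))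
  have hind := linearIndependent_toLp_of_wronskian_ne_zero hy.1.differentiable
    hw.1.differentiable hym hwm (x := 0) (by rw [hW]; exact one_ne_zero)
  rw [hspan, rank_span hind, Cardinal.mk_range_eq _ hind.injective, Cardinal.mk_fin]
  norm_num

end DeficiencySpaces

/-! ### PT-symmetry -/

section Reflection

variable {q : ℝ → ℝ} {y : ℝ → ℂ}

theorem ae_comp_neg {P : ℝ → Prop} (h : ∀ᵐ x, P x) : ∀ᵐ x : ℝ, P (-x) :=
  (Measure.measurePreserving_neg volume).quasiMeasurePreserving.ae h

theorem IsRegular.hasDerivAt_comp_neg (hy : IsRegular y) (x : ℝ) :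
    HasDerivAt (fun t => y (-t)) (-deriv y (-x)) x := by
  simpa only [neg_one_smul] using! (hy.hasDerivAt (-x)).scomp x (hasDerivAt_neg x)

theorem IsRegular.comp_neg (hy : IsRegular y) : IsRegular fun x => y (-x) :=
  .of_hasDerivAt hy.hasDerivAt_comp_neg hy.acloc_deriv.comp_neg.neg

theorem tau_comp_neg (heven : ∀ x, q x = q (-x)) (hy : IsRegular y) :
    tau q (fun x => y (-x)) = fun x => tau q y (-x) := by
  funext x
  rw [tau, tau, deriv_eq hy.hasDerivAt_comp_neg, deriv.fun_neg, deriv_comp_neg, neg_neg, ← heven x]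

theorem coeFn_pt (f : L2R) : pt f =ᵐ[volume] fun x => star (f (-x)) := by
  filter_upwards [Lp.coeFn_compMeasurePreserving (timeReversal f)
    (Measure.measurePreserving_neg volume), ae_comp_neg (Lp.coeFn_star f)] with x hparity hstar
  exact hparity.trans hstar

theorem pt_add (f g : L2R) : pt (f + g) = pt f + pt g := by
  refine Lp.ext ?_
  filter_upwards [coeFn_pt (f + g), coeFn_pt f, coeFn_pt g, Lp.coeFn_add (pt f) (pt g),
    ae_comp_neg (Lp.coeFn_add f g)] with x hfg hf hg hadd hadd'
  rw [hfg, hadd, Pi.add_apply, hf, hg, hadd', Pi.add_apply, star_add]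

theorem pt_smul (c : ℂ) (f : L2R) : pt (c • f) = star c • pt f := by
  refine Lp.ext ?_
  filter_upwards [coeFn_pt (c • f), coeFn_pt f, Lp.coeFn_smul (star c) (pt f),
    ae_comp_neg (Lp.coeFn_smul c f)] with x hcf hf hsmul hsmul'
  rw [hcf, hsmul, Pi.smul_apply, hf, hsmul', Pi.smul_apply, star_smul]

theorem norm_pt (f : L2R) : ‖pt f‖ = ‖f‖ := by
  rw [pt, parity, Lp.norm_compMeasurePreserving, timeReversal, Lp.norm_def, Lp.norm_def]
  refine congrArg ENNReal.toReal (eLpNorm_congr_norm_ae ?_)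
  filter_upwards [Lp.coeFn_star f] with x hx
  rw [hx, Pi.star_apply, norm_star]

/-- The operator `pt` as an antilinear isometry of `L²(ℝ)`. -/
noncomputable def ptₗᵢ : L2R →ₗᵢ⋆[ℂ] L2R where
  toFun := pt
  map_add' := pt_add
  map_smul' := pt_smul
  norm_map' := norm_pt

theorem involutive_ptₗᵢ : Function.Involutive ptₗᵢ := fun f => by
  change pt (pt f) = f
  refine Lp.ext ?_
  filter_upwards [coeFn_pt (pt f), ae_comp_neg (coeFn_pt f)] with x hptf hf
  rw [hptf, hf, star_star, neg_neg]

theorem commutesWith_ptₗᵢ_preminimalOperator (heven : ∀ x, q x = q (-x)) :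
    CommutesWith ptₗᵢ (preminimalOperator q) := by
  intro f g hfg
  obtain ⟨y, hy, hyc, hf, hg⟩ := mem_graph_preminimalOperator_iff.1 hfg
  refine mem_graph_preminimalOperator_iff.2 ⟨fun x => star (y (-x)), hy.comp_neg.star,
    (hyc.comp_homeomorph (Homeomorph.neg ℝ)).comp_left (g := star) (star_zero _), ?_, ?_⟩
  · filter_upwards [coeFn_pt f, ae_comp_neg hf] with x hptf hfx
    exact hptf.trans (congrArg star hfx)
  · rw [tau_star, tau_comp_neg heven hy]
    filter_upwards [coeFn_pt g, ae_comp_neg hg] with x hptg hgx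
    exact hptg.trans (congrArg star hgx)

theorem CommutesWith.isPTSymmetric {T : L2R →ₗ.[ℂ] L2R} (hcl : T.IsClosed)
    (hT : Dense (T.domain : Set L2R)) (hCT : CommutesWith ptₗᵢ T) : IsPTSymmetric T :=
  ⟨hcl, hT, fun f => ⟨hCT.map_mem_domain f.2,
    (LinearPMap.image_iff (hCT.map_mem_domain f.2)).2 (hCT _ _ (T.mem_graph f))⟩⟩

end Reflection

section LimitCircle

variable {q : ℝ → ℝ} {B : L2R →ₗ.[ℂ] L2R}

theorem rank_domainQuotient_minimalOperator_adjoint (hq : LocallyIntegrable q)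
    (htop : LimitCircleAtTop q) (hbot : LimitCircleAtBot q) :
    Module.rank ℂ (DomainQuotient (minimalOperator q) (minimalOperator q)†) = 4 := by
  rw [rank_domainQuotient_adjoint (dense_domain_minimalOperator hq) (isClosed_minimalOperator hq)
    (minimalOperator_le_adjoint hq), rank_deficiencySpace_minimalOperator hq htop hbot,
    rank_deficiencySpace_minimalOperator hq htop hbot]
  norm_num

theorem one_lt_rank_deficiencySpace_minimalOperator (hq : LocallyIntegrable q)
    (htop : LimitCircleAtTop q) (hbot : LimitCircleAtBot q) (z : ℂ) :
    ((1 : ℕ) : Cardinal) < Module.rank ℂ (deficiencySpace (minimalOperator q) z) := by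
  rw [rank_deficiencySpace_minimalOperator hq htop hbot]
  exact_mod_cast one_lt_two

theorem exists_isBiExtensionOfDim_one_isPTSymmetric (hq : LocallyIntegrable q)
    (heven : ∀ x, q x = q (-x)) (htop : LimitCircleAtTop q) (hbot : LimitCircleAtBot q) :
    ∃ B, IsBiExtensionOfDim (minimalOperator q) B 1 ∧ IsPTSymmetric B := by
  have hdense := dense_domain_minimalOperator hq
  have hne : (minimalOperator q).domain ≠ (minimalOperator q)†.domain := fun h => by
    have hrank := rank_domainQuotient_minimalOperator_adjoint hq htop hbot
    rw [rank_domainQuotient_of_domain_le h.ge] at hrank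
    norm_num at hrank
  obtain ⟨B, hB, hCB⟩ := exists_isBiExtensionOfDim_one_commutesWith ptₗᵢ involutive_ptₗᵢ
    hdense (isClosed_minimalOperator hq) (minimalOperator_le_adjoint hq) hne
    ((commutesWith_ptₗᵢ_preminimalOperator heven).closure ptₗᵢ.continuous
      (isClosable_preminimalOperator hq))
  exact ⟨B, hB, hCB.isPTSymmetric hB.1.1 (hdense.mono hB.1.2.1.1)⟩

end LimitCircle

end PTSymmetric

theorem mainTheorem2 (q : ℝ → ℝ)
    (hq : MeasureTheory.LocallyIntegrable q MeasureTheory.volume)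
    (heven : ∀ x : ℝ, q x = q (-x))
    (htop : PTSymmetric.LimitCircleAtTop q) (hbot : PTSymmetric.LimitCircleAtBot q) :
    (∀ B : PTSymmetric.L2R →ₗ.[ℂ] PTSymmetric.L2R,
      PTSymmetric.IsBiExtensionOfDim (PTSymmetric.minimalOperator q) B 1 →
        PTSymmetric.spectrum B = Set.univ ∧
        PTSymmetric.IsBiExtensionOfDim (PTSymmetric.minimalOperator q) B.adjoint 3 ∧
        PTSymmetric.resolventSet B.adjoint = ∅) ∧
    ∃ B : PTSymmetric.L2R →ₗ.[ℂ] PTSymmetric.L2R,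
      PTSymmetric.IsBiExtensionOfDim (PTSymmetric.minimalOperator q) B 1 ∧
      PTSymmetric.IsPTSymmetric B ∧ PTSymmetric.resolventSet B = ∅ := by
  have hdense := PTSymmetric.dense_domain_minimalOperator hq
  have hclosed := PTSymmetric.isClosed_minimalOperator hq
  have hdef := PTSymmetric.one_lt_rank_deficiencySpace_minimalOperator hq htop hbot
  have hdim := PTSymmetric.rank_domainQuotient_minimalOperator_adjoint hq htop hbot
  refine ⟨fun B hB => ⟨?_, hB.adjoint hdense hclosed (hdim.trans (by norm_num)),
    hB.resolventSet_adjoint_eq_empty hdense hclosed hdef⟩, ?_⟩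
  · exact Set.compl_univ_iff.2 (hB.resolventSet_eq_empty hdense hdef)
  · obtain ⟨B, hB, hPT⟩ :=
      PTSymmetric.exists_isBiExtensionOfDim_one_isPTSymmetric hq heven htop hbot
    exact ⟨B, hB, hPT, hB.resolventSet_eq_empty hdense hdef⟩
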